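/- **Setting.** Let $K$ be an imaginary quadratic field with ring of integers $\mathcal{O}_K$, $p$ a prime, $\mathfrak{n}\neq 0$ an ideal of $\mathcal{O}_K$ with $(p)\mid\mathfrak{n}$, and $I\subset\mathcal{O}_K$ an ideal coprime to $\mathfrak{n}$. Let $$\Gamma=\Gamma_I=\left\{\begin{pmatrix}a&b\\c&d\end{pmatrix}\in \mathrm{SL}_2(K): a,d\in 1+\mathfrak{n},\ b\in I,\ c\in\mathfrak{n}I^{-1}\right\}.$$ Let $L\subset\mathbb{C}_p$ be a finite extension of $\mathbb{Q}_p$ containing the images of both embeddings $\sigma_1\ne\sigma_2:K\hookrightarrow L$, let $|\cdot|$ be the absolute value extending the $p$-adic one with $|p|=p^{-1}$, and let $v=-\log_p|\cdot|$ (so $v(p)=1$). Write $\sigma_1,\sigma_2$ also for the induced maps $\mathcal{O}_K\otimes\mathbb{Z}_p\to L$, and let $k\ge 0$ be an integer. **Distributions.** For $r,s\in(0,1]$ let $B(r,s)\subset\mathbb{C}_p^2$ be the set of $(x,y)$ such that $|x-\sigma_1(u)|\le r$ and $|y-\sigma_2(u)|\le s$ for some $u\in\mathcal{O}_K\otimes\mathbb{Z}_p$.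 Let $\mathbb{A}[L,r,s]$ be the $L$-Banach space, with the sup norm, of functions $F:B(r,s)\to\mathbb{C}_p$ that, for every $u\in\mathcal{O}_K\otimes\mathbb{Z}_p$, are given on the polydisc of radii $(r,s)$ about $(\sigma_1(u),\sigma_2(u))$ by a power series $\sum a_{ij}(x-\sigma_1(u))^i(y-\sigma_2(u))^j$ with $a_{ij}\in L$ and $|a_{ij}|r^is^j\to 0$. Let $\mathcal{D}(L)$ be the continuous $L$-dual of $\varinjlim_{r,s\to0}\mathbb{A}[L,r,s]$, i.e. the space of families, compatible with restriction, of continuous functionals on the $\mathbb{A}[L,r,s]$. For $\mu\in\mathcal{D}(L)$ let $\|\mu\|_{r,s}$ be the operator norm of $\mu$ on $\mathbb{A}[L,r,s]$. Consider $g\in\mathrm{GL}_2(K)$ coming from a matrix over $\mathcal{O}_K\otimes\mathbb{Z}_p$ whose upper left entry is a unit and whose lower left entry is divisible by $p$, and write $\sigma_i(g)=\begin{pmatrix}a_i&b_i\\c_i&d_i\end{pmatrix}$. Such $g$ act by $$(g\cdot F)(x,y)=(a_1+c_1x)^k(a_2+c_2y)^kF\!\left(\frac{b_1+d_1x}{a_1+c_1x},\frac{b_2+d_2y}{a_2+c_2y}\right),\qquad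 (\mu|_k g)(F)=\mu(g\cdot F),$$ and $\mathcal{D}_{k,k}(L)$ denotes $\mathcal{D}(L)$ with this action. **Symbols.** Let $\Delta_0=\mathrm{Div}^0(\mathbb{P}^1(K))$ with the action of $\mathrm{GL}_2(K)$ by fractional linear transformations, and put $(\Psi|g)(D)=\Psi(gD)|_kg$ for $\Psi:\Delta_0\to\mathcal{D}_{k,k}(L)$. Let $\mathrm{Symb}_\Gamma(\mathcal{D}_{k,k}(L))$ be the space of homomorphisms $\Psi:\Delta_0\to\mathcal{D}_{k,k}(L)$ with $\Psi|\gamma=\Psi$ for all $\gamma\in\Gamma$. For $0\ne\beta\in\mathcal{O}_K$ and a system $S$ of representatives of $\mathcal{O}_K/(\beta)$ put $U_{(\beta)}\Psi=\sum_{a\in S}\Psi|\begin{pmatrix}1&a\\0&\beta\end{pmatrix}$, and write $U_p=U_{(p)}$. The results below hold for every choice of $\beta$ and $S$. Let $\Psi\in\mathrm{Symb}_\Gamma(\mathcal{D}_{k,k}(L))$. **(1)** Suppose $U_p\Psi=\lambda\Psi$ with $0\ne\lambda\in L$, and let $h=v(\lambda)$. Then, for every $D\in\Delta_0$, the distribution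 $\Psi(D)$ is $h$-admissible, i.e. $\|\Psi(D)\|_{r,r}=O(r^{-h})$ as $r\to0^+$. **(2)** Suppose $(p)=\mathfrak{p}\overline{\mathfrak{p}}$ splits in $K$ into distinct primes, labelled so that $|\sigma_1(x)|<1$ for $x\in\mathfrak{p}$ and $|\sigma_2(x)|<1$ for $x\in\overline{\mathfrak{p}}$, and let $n\ge1$ be such that $\mathfrak{p}^n$ and $\overline{\mathfrak{p}}^n$ are principal. Suppose $U_{\mathfrak{p}^n}\Psi=\lambda_1^n\Psi$ and $U_{\overline{\mathfrak{p}}^n}\Psi=\lambda_2^n\Psi$ with $0\neq\lambda_1,\lambda_2\in L$, and let $h_i=v(\lambda_i)$. Then, for every $D\in\Delta_0$, the distribution $\Psi(D)$ is $(h_1,h_2)$-admissible, in the following sense: $\|\Psi(D)\|_{r,s}=O(r^{-h_1})$ uniformly for $s$ bounded away from $0$; $\|\Psi(D)\|_{r,s}=O(s^{-h_2})$ uniformly for $r$ bounded away from $0$; and jointly $\|\Psi(D)\|_{r,s}\le C\,r^{-h_1}s^{-h_2}$ for all $r,s\in(0,1]$, with $C$ independent of $r,s$. -/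

import Mathlib

namespace BianchiSymb

section Series

open Filter Topology Finset

variable {L C : Type*} [NormedField L] [NormedField C] [NormedAlgebra L C]

/-- `f` is given on the closed unit disc by a power series over `L` whose `j`-th coefficient is
bounded by `q ^ j`. -/
def UnitSeries (L : Type*) {C : Type*} [NormedField L] [NormedField C] [NormedAlgebra L C]
    (q : ℝ) (f : C → C) : Prop :=
  ∃ v : ℕ → L, (∀ j, ‖v j‖ ≤ q ^ j) ∧
    ∀ t : C, ‖t‖ ≤ 1 → HasSum (fun j => algebraMap L C (v j) * t ^ j) (f t)

theorem UnitSeries.mul [IsUltrametricDist L] [IsUltrametricDist C] {q : ℝ} (hq : 0 ≤ q)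
    {f g : C → C} (hf : UnitSeries L q f) (hg : UnitSeries L q g) :
    UnitSeries L q (fun t => f t * g t) := by
  obtain ⟨v, hv, hvs⟩ := hf
  obtain ⟨w, hw, hws⟩ := hg
  refine ⟨fun n => ∑ x ∈ antidiagonal n, v x.1 * w x.2, fun n => ?_, fun t ht => ?_⟩
  · refine IsUltrametricDist.norm_sum_le_of_forall_le_of_nonneg (pow_nonneg hq n) fun x hx => ?_
    rw [norm_mul, ← mem_antidiagonal.1 hx, pow_add]
    exact mul_le_mul (hv _) (hw _) (norm_nonneg _) (pow_nonneg hq _)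
  · have : NonarchimedeanRing C :=
      { is_nonarchimedean := NonarchimedeanAddGroup.is_nonarchimedean }
    have h := (hvs t ht).mul_of_nonarchimedean (hws t ht)
    rw [← Finset.HasAntidiagonal.sigmaAntidiagonalEquivProd.hasSum_iff] at h
    refine h.sigma fun n => ?_
    have h2 := hasSum_fintype (fun c : antidiagonal n =>
      (algebraMap L C (v c.1.1) * t ^ c.1.1) * (algebraMap L C (w c.1.2) * t ^ c.1.2))
    refine (congrArg (HasSum _) ?_).mp h2
    rw [Finset.sum_coe_sort (antidiagonal n) (fun c : ℕ × ℕ =>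
      (algebraMap L C (v c.1) * t ^ c.1) * (algebraMap L C (w c.2) * t ^ c.2)), map_sum,
      Finset.sum_mul]
    refine Finset.sum_congr rfl fun x hx => ?_
    rw [← mem_antidiagonal.1 hx, map_mul, pow_add]
    ring

theorem UnitSeries.linear {q : ℝ} (hq : 0 ≤ q) (α κ : L) (hα : ‖α‖ ≤ 1) (hκ : ‖κ‖ ≤ q) :
    UnitSeries L q (fun t : C => algebraMap L C α + algebraMap L C κ * t) := by
  refine ⟨fun j => if j = 0 then α else if j = 1 then κ else 0, fun j => ?_, fun t _ => ?_⟩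
  · match j with
    | 0 => simpa using hα
    | 1 => simpa using hκ
    | j + 2 => simpa using pow_nonneg hq (j + 2)
  · have := hasSum_sum_of_ne_finset_zero (s := Finset.range 2) (L := .unconditional ℕ)
      (f := fun j => algebraMap L C (if j = 0 then α else if j = 1 then κ else 0) * t ^ j)
      (by intro b hb; have : 1 < b := by simpa using hb
          simp [show b ≠ 0 by omega, show b ≠ 1 by omega])
    simpa [Finset.sum_range_succ] using this

theorem UnitSeries.inv {q : ℝ} (hq1 : q < 1) (α κ : L) (hα : ‖α‖ = 1)
    (hκ : ‖κ‖ ≤ q) :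
    UnitSeries L q (fun t : C => (algebraMap L C α + algebraMap L C κ * t)⁻¹) := by
  have hα0 : α ≠ 0 := by rintro rfl; simp at hα
  have hα0' : algebraMap L C α ≠ 0 := by simpa using hα0
  refine ⟨fun j => α⁻¹ * (-(κ / α)) ^ j, fun j => ?_, fun t ht => ?_⟩
  · simp only [norm_mul, norm_inv, hα, norm_pow, norm_neg, norm_div]
    simpa using pow_le_pow_left₀ (norm_nonneg _) hκ j
  · have hlt : ‖-(algebraMap L C κ / algebraMap L C α) * t‖ < 1 := by
      simp only [norm_mul, norm_neg, norm_div, norm_algebraMap', hα, div_one]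
      calc ‖κ‖ * ‖t‖ ≤ ‖κ‖ * 1 := by gcongr
        _ ≤ q := by simpa using hκ
        _ < 1 := hq1
    have h := (hasSum_geometric_of_norm_lt_one hlt).mul_left (algebraMap L C α)⁻¹
    have e1 : (algebraMap L C α)⁻¹ * (1 - -(algebraMap L C κ / algebraMap L C α) * t)⁻¹ =
        (algebraMap L C α + algebraMap L C κ * t)⁻¹ := by
      rw [← mul_inv]; congr 1; field_simp; ring
    rw [e1] at h
    refine (congrArg (HasSum · _) (funext fun j => ?_)).mp h
    simp only [map_mul, map_inv₀, map_pow, map_neg, map_div₀]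
    ring

theorem UnitSeries.pow [IsUltrametricDist L] [IsUltrametricDist C] {q : ℝ} (hq : 0 ≤ q)
    {f : C → C} (hf : UnitSeries L q f) (n : ℕ) : UnitSeries L q (fun t => f t ^ n) := by
  induction n with
  | zero => simpa using UnitSeries.linear (C := C) hq (1 : L) 0 (by simp) (by simpa using hq)
  | succ n ih => simpa [pow_succ] using ih.mul hq hf

theorem series_compose [IsUltrametricDist L] [IsUltrametricDist C] [CompleteSpace C]
    {q r s : ℝ} (hq : 0 ≤ q) (hq1 : q < 1) (hr : 0 < r) (hr1 : r ≤ 1) (hs : 0 < s) (hs1 : s ≤ 1)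
    {h h' : ℕ → C → C} (hh : ∀ i, UnitSeries L q (h i)) (hh' : ∀ i, UnitSeries L q (h' i))
    {a : ℕ × ℕ → L} (ha : Tendsto (fun i => ‖a i‖ * r ^ i.1 * s ^ i.2) cofinite (𝓝 0)) :
    ∃ b : ℕ × ℕ → L, Tendsto (fun i => ‖b i‖ * r ^ i.1 * s ^ i.2) cofinite (𝓝 0) ∧
      ∀ (t₁ t₂ S : C), ‖t₁‖ ≤ r → ‖t₂‖ ≤ s →
        HasSum (fun i => algebraMap L C (a i) * (t₁ ^ i.1 * h i.1 t₁) * (t₂ ^ i.2 * h' i.2 t₂)) S →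
        HasSum (fun i => algebraMap L C (b i) * t₁ ^ i.1 * t₂ ^ i.2) S := by
  choose v hv hvs using hh
  choose w hw hws using hh'
  let _ : HasAntidiagonal (ℕ × ℕ) := Finset.HasAntidiagonal.antidiagonalOfLocallyFinite
  have hqt : Tendsto (fun j : ℕ × ℕ => q ^ j.1 * q ^ j.2) cofinite (𝓝 0) := by
    have : Tendsto (fun j : ℕ => q ^ j) cofinite (𝓝 0) := by
      rw [Nat.cofinite_eq_atTop]; exact tendsto_pow_atTop_nhds_zero_of_lt_one hq hq1
    exact tendsto_mul_cofinite_nhds_zero this this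
  have hT := tendsto_mul_cofinite_nhds_zero ha hqt
  refine ⟨fun m => ∑ x ∈ antidiagonal m, a x.1 * v x.1.1 x.2.1 * w x.1.2 x.2.2, ?_, ?_⟩
  · rw [Metric.tendsto_nhds]
    intro ε hε
    have h1 : ∀ᶠ x : (ℕ × ℕ) × (ℕ × ℕ) in cofinite,
        (‖a x.1‖ * r ^ x.1.1 * s ^ x.1.2) * (q ^ x.2.1 * q ^ x.2.2) < ε / 2 :=
      hT.eventually (gt_mem_nhds (half_pos hε))
    rw [eventually_cofinite] at h1 ⊢
    refine (h1.image (fun x => x.1 + x.2)).subset ?_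
    intro m hm
    by_contra hcon
    apply hm
    have h2 : ∀ x ∈ antidiagonal m,
        (‖a x.1‖ * r ^ x.1.1 * s ^ x.1.2) * (q ^ x.2.1 * q ^ x.2.2) < ε / 2 := by
      intro x hx
      by_contra hx2
      exact hcon ⟨x, hx2, mem_antidiagonal.1 hx⟩
    have h3 : ‖∑ x ∈ antidiagonal m, a x.1 * v x.1.1 x.2.1 * w x.1.2 x.2.2‖
        ≤ ε / 2 / (r ^ m.1 * s ^ m.2) := by
      refine IsUltrametricDist.norm_sum_le_of_forall_le_of_nonneg (by positivity) fun x hx => ?_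
      rw [le_div_iff₀ (by positivity), norm_mul, norm_mul]
      refine le_trans ?_ (h2 x hx).le
      rw [← mem_antidiagonal.1 hx]
      have e1 : r ^ (x.1 + x.2).1 ≤ r ^ x.1.1 :=
        pow_le_pow_of_le_one hr.le hr1 (by simp)
      have e2 : s ^ (x.1 + x.2).2 ≤ s ^ x.1.2 :=
        pow_le_pow_of_le_one hs.le hs1 (by simp)
      calc ‖a x.1‖ * ‖v x.1.1 x.2.1‖ * ‖w x.1.2 x.2.2‖ * (r ^ (x.1 + x.2).1 * s ^ (x.1 + x.2).2)
          ≤ ‖a x.1‖ * q ^ x.2.1 * q ^ x.2.2 * (r ^ x.1.1 * s ^ x.1.2) := by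
            gcongr
            · exact hv _ _
            · exact hw _ _
        _ = _ := by ring
    rw [Real.dist_eq, sub_zero, mul_assoc, abs_of_nonneg (by positivity)]
    rw [le_div_iff₀ (by positivity)] at h3
    linarith
  · intro t₁ t₂ S ht₁ ht₂ hS
    have hsum : Summable (fun x : (ℕ × ℕ) × (ℕ × ℕ) =>
        algebraMap L C (a x.1 * v x.1.1 x.2.1 * w x.1.2 x.2.2) *
          t₁ ^ (x.1 + x.2).1 * t₂ ^ (x.1 + x.2).2) := by
      apply NonarchimedeanAddGroup.summable_of_tendsto_cofinite_zero
      refine squeeze_zero_norm (fun x => ?_) hT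
      rw [norm_mul, norm_mul, norm_algebraMap', norm_mul, norm_mul, norm_pow, norm_pow]
      have e1 : ‖t₁‖ ^ (x.1 + x.2).1 ≤ r ^ x.1.1 :=
        (pow_le_pow_left₀ (norm_nonneg _) ht₁ _).trans
          (pow_le_pow_of_le_one hr.le hr1 (by simp))
      have e2 : ‖t₂‖ ^ (x.1 + x.2).2 ≤ s ^ x.1.2 :=
        (pow_le_pow_left₀ (norm_nonneg _) ht₂ _).trans
          (pow_le_pow_of_le_one hs.le hs1 (by simp))
      calc _ ≤ ‖a x.1‖ * q ^ x.2.1 * q ^ x.2.2 * r ^ x.1.1 * s ^ x.1.2 := by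
            gcongr
            · exact hv _ _
            · exact hw _ _
        _ = _ := by ring
    have : NonarchimedeanRing C :=
      { is_nonarchimedean := NonarchimedeanAddGroup.is_nonarchimedean }
    have hfib := hsum.hasSum.prod_fiberwise (g := fun i : ℕ × ℕ =>
      algebraMap L C (a i) * (t₁ ^ i.1 * h i.1 t₁) * (t₂ ^ i.2 * h' i.2 t₂)) (fun i => by
        have h1 := (hvs i.1 t₁ (ht₁.trans hr1)).mul_of_nonarchimedean
          (hws i.2 t₂ (ht₂.trans hs1))
        have h2 := h1.mul_left (algebraMap L C (a i) * t₁ ^ i.1 * t₂ ^ i.2)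
        have e1 : algebraMap L C (a i) * t₁ ^ i.1 * t₂ ^ i.2 * (h i.1 t₁ * h' i.2 t₂) =
            algebraMap L C (a i) * (t₁ ^ i.1 * h i.1 t₁) * (t₂ ^ i.2 * h' i.2 t₂) := by ring
        rw [e1] at h2
        refine (congrArg (HasSum · _) (funext fun j => ?_)).mp h2
        simp only [map_mul, Prod.fst_add, Prod.snd_add, pow_add]
        ring)
    have hkey := hsum.hasSum
    rw [hfib.unique hS, ← Finset.HasAntidiagonal.sigmaAntidiagonalEquivProd.hasSum_iff] at hkey
    refine hkey.sigma fun m => ?_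
    have h2 := hasSum_fintype (fun c : antidiagonal m =>
      algebraMap L C (a c.1.1 * v c.1.1.1 c.1.2.1 * w c.1.1.2 c.1.2.2) *
          t₁ ^ (c.1.1 + c.1.2).1 * t₂ ^ (c.1.1 + c.1.2).2)
    refine (congrArg (HasSum _) ?_).mp h2
    rw [Finset.sum_coe_sort (antidiagonal m) (fun c : (ℕ × ℕ) × (ℕ × ℕ) =>
      algebraMap L C (a c.1 * v c.1.1 c.2.1 * w c.1.2 c.2.2) *
          t₁ ^ (c.1 + c.2).1 * t₂ ^ (c.1 + c.2).2), map_sum,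
      Finset.sum_mul, Finset.sum_mul]
    refine Finset.sum_congr rfl fun x hx => ?_
    rw [mem_antidiagonal.1 hx]

end Series

section Setup

open Filter Topology Asymptotics
open scoped NumberField TensorProduct BoundedContinuousFunction

variable (p : ℕ) [Fact p.Prime] (K : Type*) [Field K]

/-- The ring `𝓞_K ⊗ ℤ_p`. -/
abbrev LocalIntegers : Type _ := ℤ_[p] ⊗[ℤ] 𝓞 K

variable {K} {L : Type*} [NontriviallyNormedField L] [NormedAlgebra ℚ_[p] L]

/-- The map `𝓞_K ⊗ ℤ_p → L` induced by an embedding `σ : K → L`. -/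
noncomputable def localEmb (σ : K →+* L) : LocalIntegers p K →+* L :=
  (Algebra.TensorProduct.productMap
    ((algebraMap ℚ_[p] L).comp PadicInt.Coe.ringHom).toIntAlgHom
    (σ.comp (algebraMap (𝓞 K) K)).toIntAlgHom).toRingHom

theorem localEmb_tmul (σ : K →+* L) (x : ℤ_[p]) (y : 𝓞 K) :
    localEmb p σ (x ⊗ₜ y) = algebraMap ℚ_[p] L x * σ y := by
  simp only [localEmb, AlgHom.toRingHom_eq_coe, RingHom.coe_coe,
    Algebra.TensorProduct.productMap_apply_tmul]
  rfl

theorem localEmb_one_tmul (σ : K →+* L) (y : 𝓞 K) :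
    localEmb p σ (1 ⊗ₜ y) = σ y := by
  simp [localEmb_tmul]

theorem norm_embedding_le_one (p : ℕ) [Fact p.Prime] {K : Type*} [Field K] {L : Type*}
    [NontriviallyNormedField L] [NormedAlgebra ℚ_[p] L] (σ : K →+* L) (y : 𝓞 K) :
    ‖σ y‖ ≤ 1 := by
  have : IsUltrametricDist L := IsUltrametricDist.of_normedAlgebra ℚ_[p]
  have hint : IsIntegral ℤ (σ y) := y.2.map σ.toIntAlgHom
  have h1 : IsIntegral (NormedField.valuation (K := L)).integer (σ y) := hint.tower_top
  have h2 := (Valuation.integer.integers (NormedField.valuation (K := L))).mem_of_integral h1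
  exact_mod_cast h2

theorem norm_localEmb_le_one (σ : K →+* L) (u : LocalIntegers p K) : ‖localEmb p σ u‖ ≤ 1 := by
  have : IsUltrametricDist L := IsUltrametricDist.of_normedAlgebra ℚ_[p]
  induction u using TensorProduct.induction_on with
  | zero => simp
  | tmul x y =>
    rw [localEmb_tmul, norm_mul, norm_algebraMap']
    exact mul_le_one₀ (PadicInt.norm_le_one x) (norm_nonneg _) (norm_embedding_le_one p σ y)
  | add x y hx hy =>
    rw [map_add]
    exact (IsUltrametricDist.norm_add_le_max _ _).trans (max_le hx hy)

theorem norm_localEmb_of_isUnit (σ : K →+* L) {u : LocalIntegers p K} (hu : IsUnit u) :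
    ‖localEmb p σ u‖ = 1 := by
  obtain ⟨u, rfl⟩ := hu
  refine le_antisymm (norm_localEmb_le_one p σ _) ?_
  have h : ‖localEmb p σ (u : LocalIntegers p K)‖ *
      ‖localEmb p σ ((u⁻¹ : (LocalIntegers p K)ˣ) : LocalIntegers p K)‖ = 1 := by
    rw [← norm_mul, ← map_mul, Units.mul_inv, map_one, norm_one]
  rw [← h]
  exact mul_le_of_le_one_right (norm_nonneg _) (norm_localEmb_le_one p σ _)

variable (K) in
theorem isUnit_add_of_dvd {x y : LocalIntegers p K} (hx : IsUnit x)
    (hy : (p : LocalIntegers p K) ∣ y) : IsUnit (x + y) := by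
  by_contra hcon
  obtain ⟨m, hm, hmem⟩ := exists_max_ideal_of_mem_nonunits (mem_nonunits_iff.2 hcon)
  have hmax : (m.comap (algebraMap ℤ_[p] (LocalIntegers p K))).IsMaximal :=
    Ideal.isMaximal_comap_of_isIntegral_of_isMaximal m
  have hp : (p : ℤ_[p]) ∈ m.comap (algebraMap ℤ_[p] (LocalIntegers p K)) := by
    rw [IsLocalRing.eq_maximalIdeal hmax, PadicInt.maximalIdeal_eq_span_p]
    exact Ideal.mem_span_singleton_self _
  have hp' : (p : LocalIntegers p K) ∈ m := by simpa using hp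
  have : x ∈ m := by simpa using m.sub_mem hmem (m.mem_of_dvd hy hp')
  exact hm.ne_top (Ideal.eq_top_of_isUnit_mem _ this hx)

/-- The matrices in `GL₂(K)` whose image under `(σ₁, σ₂)` comes from a matrix
`(a, b; c, d)` over `𝓞_K ⊗ ℤ_p` with `a` a unit and `p ∣ c`. -/
def IsSigmaZero (σ₁ σ₂ : K →+* L) (g : GL (Fin 2) K) : Prop :=
  ∃ m : Matrix (Fin 2) (Fin 2) (LocalIntegers p K),
    IsUnit (m 0 0) ∧ (p : LocalIntegers p K) ∣ m 1 0 ∧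
    ∀ i j, localEmb p σ₁ (m i j) = σ₁ (g i j) ∧ localEmb p σ₂ (m i j) = σ₂ (g i j)

variable [NormedAlgebra L ℂ_[p]]

/-- The `(r, s)`-neighbourhood of `𝓞_K ⊗ ℤ_p` in `ℂ_p²`. -/
def Nbhd (σ₁ σ₂ : K →+* L) (r s : ℝ) : Set (ℂ_[p] × ℂ_[p]) :=
  {z | ∃ u : LocalIntegers p K, ‖z.1 - algebraMap L ℂ_[p] (localEmb p σ₁ u)‖ ≤ r ∧
    ‖z.2 - algebraMap L ℂ_[p] (localEmb p σ₂ u)‖ ≤ s}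

/-- `F` is given on each polydisc of radii `(r, s)` around a point of `𝓞_K ⊗ ℤ_p` by a power
series `∑ a_{ij} (x - σ₁(u))^i (y - σ₂(u))^j` with coefficients in `L` such that
`|a_{ij}| r^i s^j → 0`. -/
def IsRigid (σ₁ σ₂ : K →+* L) (r s : ℝ) (F : Nbhd p σ₁ σ₂ r s → ℂ_[p]) : Prop :=
  ∀ u : LocalIntegers p K, ∃ a : ℕ × ℕ → L,
    Tendsto (fun i => ‖a i‖ * r ^ i.1 * s ^ i.2) cofinite (𝓝 0) ∧
    ∀ z : Nbhd p σ₁ σ₂ r s,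
      ‖z.1.1 - algebraMap L ℂ_[p] (localEmb p σ₁ u)‖ ≤ r →
      ‖z.1.2 - algebraMap L ℂ_[p] (localEmb p σ₂ u)‖ ≤ s →
      HasSum (fun i : ℕ × ℕ => algebraMap L ℂ_[p] (a i) *
        (z.1.1 - algebraMap L ℂ_[p] (localEmb p σ₁ u)) ^ i.1 *
        (z.1.2 - algebraMap L ℂ_[p] (localEmb p σ₂ u)) ^ i.2) (F z)

/-- The `L`-Banach space `𝔸[L, r, s]` of rigid analytic functions on the `(r, s)`-neighbourhood
that are defined over `L`, with the sup norm. Rigid analytic functions are automatically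
continuous and bounded, since the neighbourhood is a finite union of open-closed polydiscs. -/
def RigidFun (σ₁ σ₂ : K →+* L) (r s : ℝ) : Submodule L (Nbhd p σ₁ σ₂ r s →ᵇ ℂ_[p]) where
  carrier := {F | IsRigid p σ₁ σ₂ r s F}
  zero_mem' := fun _ => ⟨0, by simp, fun _ _ _ => by simp⟩
  add_mem' := by
    intro F G hF hG u
    obtain ⟨a, ha, haF⟩ := hF u
    obtain ⟨b, hb, hbG⟩ := hG u
    refine ⟨a + b, ?_, fun z h₁ h₂ => ?_⟩
    · have hr0 : 0 ≤ |r| := abs_nonneg r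
      have hab := (ha.norm.add hb.norm)
      simp only [norm_zero, add_zero] at hab
      refine squeeze_zero_norm (fun i => ?_) hab
      simp only [norm_mul, norm_norm, Pi.add_apply, ← add_mul]
      gcongr
      exact norm_add_le _ _
    · have := (haF z h₁ h₂).add (hbG z h₁ h₂)
      refine (congrArg (HasSum · _) (funext fun j => ?_)).mp this
      simp only [Pi.add_apply, map_add]
      ring
  smul_mem' := by
    intro c F hF u
    obtain ⟨a, ha, haF⟩ := hF u
    refine ⟨c • a, ?_, fun z h₁ h₂ => ?_⟩
    · have := ha.const_mul ‖c‖
      simpa [norm_mul, mul_assoc] using this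
    · have := (haF z h₁ h₂).mul_left (algebraMap L ℂ_[p] c)
      have e1 : algebraMap L ℂ_[p] c * F z = (c • F) z := by
        rw [BoundedContinuousFunction.smul_apply, Algebra.smul_def]
      rw [e1] at this
      refine (congrArg (HasSum · _) (funext fun j => ?_)).mp this
      simp only [Pi.smul_apply, smul_eq_mul, map_mul]
      ring

theorem Nbhd_mono (σ₁ σ₂ : K →+* L) {r s r' s' : ℝ} (hr : r ≤ r') (hs : s ≤ s') :
    Nbhd p σ₁ σ₂ r s ⊆ Nbhd p σ₁ σ₂ r' s' :=
  fun _ ⟨u, h₁, h₂⟩ => ⟨u, h₁.trans hr, h₂.trans hs⟩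

/-- Radii of neighbourhoods; restricting to radii at most `1` is harmless for the limits below
and guarantees that `Γ` acts on the neighbourhoods. -/
abbrev Radius : Type := Set.Ioc (0 : ℝ) 1

/-- Restriction `𝔸[L, r', s'] → 𝔸[L, r, s]` for `r ≤ r'` and `s ≤ s'`. -/
noncomputable def RigidFun.res (σ₁ σ₂ : K →+* L) {ρ ρ' : Radius × Radius} (h : ρ ≤ ρ') :
    RigidFun p σ₁ σ₂ ρ'.1 ρ'.2 →ₗ[L] RigidFun p σ₁ σ₂ ρ.1 ρ.2 where
  toFun F := ⟨F.1.compContinuous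
      ⟨Set.inclusion (Nbhd_mono p σ₁ σ₂ h.1 h.2), continuous_inclusion _⟩, by
    intro u
    obtain ⟨a, ha, haF⟩ := F.2 u
    refine ⟨a, ?_, fun z h₁ h₂ => haF (Set.inclusion (Nbhd_mono p σ₁ σ₂ h.1 h.2) z)
      (h₁.trans h.1) (h₂.trans h.2)⟩
    have h1 : (0 : ℝ) ≤ ρ.1 := ρ.1.2.1.le
    have h2 : (0 : ℝ) ≤ ρ.2 := ρ.2.2.1.le
    have h1' : (ρ.1 : ℝ) ≤ ρ'.1 := h.1
    have h2' : (ρ.2 : ℝ) ≤ ρ'.2 := h.2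
    have h3 : (0 : ℝ) ≤ ρ'.1 := ρ'.1.2.1.le
    refine squeeze_zero (fun i => by positivity) (fun i => ?_) ha
    gcongr⟩
  map_add' _ _ := rfl
  map_smul' _ _ := rfl

/-- The space `𝒟(L)` of `L`-valued locally analytic distributions: continuous linear functionals
on the direct limit of the Banach spaces `𝔸[L, r, s]`, that is, compatible families of continuous
linear functionals on the `𝔸[L, r, s]`. -/
def LocDist (σ₁ σ₂ : K →+* L) :
    Submodule L (∀ ρ : Radius × Radius, RigidFun p σ₁ σ₂ ρ.1 ρ.2 →L[L] L) where
  carrier := {μ | ∀ (ρ ρ' : Radius × Radius) (h : ρ ≤ ρ') (F : RigidFun p σ₁ σ₂ ρ'.1 ρ'.2),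
    μ ρ (RigidFun.res p σ₁ σ₂ h F) = μ ρ' F}
  zero_mem' := fun _ _ _ _ => rfl
  add_mem' := by
    intro μ ν hμ hν ρ ρ' h F
    simp [hμ ρ ρ' h F, hν ρ ρ' h F]
  smul_mem' := by
    intro c μ hμ ρ ρ' h F
    simp [hμ ρ ρ' h F]

/-- The operator norm `‖μ‖_{r,s}`. -/
noncomputable def distNorm {σ₁ σ₂ : K →+* L} (μ : LocDist p σ₁ σ₂) (r s : Radius) : ℝ :=
  ‖μ.1 (r, s)‖


/-- The automorphy factor `a + c z`, for `z ∈ ℂ_p` and the matrix `σ(g) = (a, b; c, d)`. -/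
noncomputable def autFactor (σ : K →+* L) (g : GL (Fin 2) K) (z : ℂ_[p]) : ℂ_[p] :=
  algebraMap L ℂ_[p] (σ (g 0 0)) + algebraMap L ℂ_[p] (σ (g 1 0)) * z

/-- The transformation `z ↦ (b + d z) / (a + c z)` of `ℂ_p`, for `σ(g) = (a, b; c, d)`. -/
noncomputable def moebius (σ : K →+* L) (g : GL (Fin 2) K) (z : ℂ_[p]) : ℂ_[p] :=
  (algebraMap L ℂ_[p] (σ (g 0 1)) + algebraMap L ℂ_[p] (σ (g 1 1)) * z) / autFactor p σ g z

/-- The local expansion of the transformation attached to `g` around a point `u`. -/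
theorem moebius_local (σ : K →+* L) (g : GL (Fin 2) K)
    (m : Matrix (Fin 2) (Fin 2) (LocalIntegers p K)) (h0 : IsUnit (m 0 0))
    (h1 : (p : LocalIntegers p K) ∣ m 1 0) (h2 : ∀ i j, localEmb p σ (m i j) = σ (g i j))
    (u : LocalIntegers p K) :
    ∃ α κ δ : L, ‖α‖ = 1 ∧ ‖κ‖ ≤ (p : ℝ)⁻¹ ∧ ‖δ‖ ≤ 1 ∧
      ∀ z : ℂ_[p], ‖z - algebraMap L ℂ_[p] (localEmb p σ u)‖ ≤ 1 →
        ‖autFactor p σ g z‖ = 1 ∧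
        autFactor p σ g z = algebraMap L ℂ_[p] α +
          algebraMap L ℂ_[p] κ * (z - algebraMap L ℂ_[p] (localEmb p σ u)) ∧
        moebius p σ g z - algebraMap L ℂ_[p] (localEmb p σ
            ((m 0 1 + m 1 1 * u) * Ring.inverse (m 0 0 + m 1 0 * u))) =
          algebraMap L ℂ_[p] δ * (z - algebraMap L ℂ_[p] (localEmb p σ u)) *
            (autFactor p σ g z)⁻¹ := by
  have hunit : IsUnit (m 0 0 + m 1 0 * u) := isUnit_add_of_dvd p K h0 (h1.mul_right u)
  have hα := norm_localEmb_of_isUnit p σ hunit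
  set α := localEmb p σ (m 0 0 + m 1 0 * u) with hαdef
  have hα0 : α ≠ 0 := by intro h; rw [h] at hα; simp at hα
  have hinv : localEmb p σ (Ring.inverse (m 0 0 + m 1 0 * u)) = α⁻¹ := by
    refine eq_inv_of_mul_eq_one_left ?_
    rw [hαdef, ← map_mul, Ring.inverse_mul_cancel _ hunit, map_one]
  have hκ : ‖σ (g 1 0)‖ ≤ (p : ℝ)⁻¹ := by
    obtain ⟨y, hy⟩ := h1
    rw [← h2, hy, map_mul, norm_mul, map_natCast, ← map_natCast (algebraMap ℚ_[p] L),
      norm_algebraMap', Padic.norm_p]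
    exact mul_le_of_le_one_right (by positivity) (norm_localEmb_le_one p σ y)
  have hp1 : (p : ℝ)⁻¹ < 1 :=
    inv_lt_one_of_one_lt₀ (by exact_mod_cast (Fact.out : p.Prime).one_lt)
  refine ⟨α, σ (g 1 0), localEmb p σ (m 0 0 * m 1 1 - m 0 1 * m 1 0) * α⁻¹, hα, hκ, ?_, ?_⟩
  · rw [norm_mul, norm_inv, hα, inv_one, mul_one]
    exact norm_localEmb_le_one p σ _
  · intro z hz
    have e1 : autFactor p σ g z = algebraMap L ℂ_[p] α + algebraMap L ℂ_[p] (σ (g 1 0)) *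
        (z - algebraMap L ℂ_[p] (localEmb p σ u)) := by
      rw [autFactor, hαdef, map_add, map_mul, h2, h2, map_add, map_mul]
      ring
    have e2 : ‖autFactor p σ g z‖ = 1 := by
      have hlt : ‖algebraMap L ℂ_[p] (σ (g 1 0)) *
          (z - algebraMap L ℂ_[p] (localEmb p σ u))‖ < ‖algebraMap L ℂ_[p] α‖ := by
        rw [norm_algebraMap', hα, norm_mul, norm_algebraMap']
        calc _ ≤ ‖σ (g 1 0)‖ * 1 := by gcongr
          _ < 1 := by rw [mul_one]; exact hκ.trans_lt hp1
      rw [e1, IsUltrametricDist.norm_add_eq_max_of_norm_ne_norm hlt.ne', max_eq_left hlt.le,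
        norm_algebraMap', hα]
    have e3 : autFactor p σ g z ≠ 0 := by intro h; rw [h] at e2; simp at e2
    refine ⟨e2, e1, ?_⟩
    have hα0' : algebraMap L ℂ_[p] α ≠ 0 := by simpa using hα0
    rw [map_mul, hinv, moebius, div_eq_mul_inv]
    have key : (algebraMap L ℂ_[p] (σ (g 0 1)) + algebraMap L ℂ_[p] (σ (g 1 1)) * z) *
        algebraMap L ℂ_[p] α - algebraMap L ℂ_[p] (localEmb p σ (m 0 1 + m 1 1 * u)) *
        autFactor p σ g z = algebraMap L ℂ_[p] (localEmb p σ
          (m 0 0 * m 1 1 - m 0 1 * m 1 0)) * (z - algebraMap L ℂ_[p] (localEmb p σ u)) := by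
      simp only [hαdef, autFactor, map_add, map_sub, map_mul, h2]
      ring
    rw [map_mul, map_mul, map_inv₀]
    field_simp
    linear_combination key

/-- The transformation attached to `g` preserves the neighbourhoods. -/
theorem moebius_mem (σ₁ σ₂ : K →+* L) {g : GL (Fin 2) K} (hg : IsSigmaZero p σ₁ σ₂ g)
    (r s : Radius) {z : ℂ_[p] × ℂ_[p]} (hz : z ∈ Nbhd p σ₁ σ₂ r s) :
    (moebius p σ₁ g z.1, moebius p σ₂ g z.2) ∈ Nbhd p σ₁ σ₂ r s ∧
      ‖autFactor p σ₁ g z.1‖ = 1 ∧ ‖autFactor p σ₂ g z.2‖ = 1 := by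
  obtain ⟨m, h0, h1, h2⟩ := hg
  obtain ⟨u, hu₁, hu₂⟩ := hz
  obtain ⟨α, κ, δ, -, -, hδ, H⟩ := moebius_local p σ₁ g m h0 h1 (fun i j => (h2 i j).1) u
  obtain ⟨α', κ', δ', -, -, hδ', H'⟩ := moebius_local p σ₂ g m h0 h1 (fun i j => (h2 i j).2) u
  obtain ⟨ha, -, hb⟩ := H z.1 (hu₁.trans r.2.2)
  obtain ⟨ha', -, hb'⟩ := H' z.2 (hu₂.trans s.2.2)
  refine ⟨⟨(m 0 1 + m 1 1 * u) * Ring.inverse (m 0 0 + m 1 0 * u), ?_, ?_⟩, ha, ha'⟩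
  · rw [hb, norm_mul, norm_mul, norm_inv, ha, inv_one, mul_one, norm_algebraMap']
    exact (mul_le_of_le_one_left (norm_nonneg _) hδ).trans hu₁
  · rw [hb', norm_mul, norm_mul, norm_inv, ha', inv_one, mul_one, norm_algebraMap']
    exact (mul_le_of_le_one_left (norm_nonneg _) hδ').trans hu₂

/-- The function
`(x, y) ↦ (a₁ + c₁ x)^k (a₂ + c₂ y)^k F((b₁ + d₁ x)/(a₁ + c₁ x), (b₂ + d₂ y)/(a₂ + c₂ y))`, where
`(aᵢ, bᵢ; cᵢ, dᵢ) = σᵢ(g)`. -/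
noncomputable def weightFun (σ₁ σ₂ : K →+* L) (k : ℕ) {g : GL (Fin 2) K}
    (hg : IsSigmaZero p σ₁ σ₂ g) (r s : Radius) (F : Nbhd p σ₁ σ₂ r s → ℂ_[p])
    (z : Nbhd p σ₁ σ₂ r s) : ℂ_[p] :=
  autFactor p σ₁ g z.1.1 ^ k * autFactor p σ₂ g z.1.2 ^ k *
    F ⟨(moebius p σ₁ g z.1.1, moebius p σ₂ g z.1.2), (moebius_mem p σ₁ σ₂ hg r s z.2).1⟩

theorem norm_weightFun (σ₁ σ₂ : K →+* L) (k : ℕ) {g : GL (Fin 2) K}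
    (hg : IsSigmaZero p σ₁ σ₂ g) (r s : Radius) (F : Nbhd p σ₁ σ₂ r s → ℂ_[p])
    (z : Nbhd p σ₁ σ₂ r s) :
    ‖weightFun p σ₁ σ₂ k hg r s F z‖ = ‖F ⟨(moebius p σ₁ g z.1.1, moebius p σ₂ g z.1.2),
      (moebius_mem p σ₁ σ₂ hg r s z.2).1⟩‖ := by
  obtain ⟨-, h₁, h₂⟩ := moebius_mem p σ₁ σ₂ hg r s z.2
  simp [weightFun, h₁, h₂]

theorem continuous_weightFun (σ₁ σ₂ : K →+* L) (k : ℕ) {g : GL (Fin 2) K}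
    (hg : IsSigmaZero p σ₁ σ₂ g) (r s : Radius) {F : Nbhd p σ₁ σ₂ r s → ℂ_[p]}
    (hF : Continuous F) : Continuous (weightFun p σ₁ σ₂ k hg r s F) := by
  have hne₁ : ∀ z : Nbhd p σ₁ σ₂ r s, autFactor p σ₁ g z.1.1 ≠ 0 := fun z h => by
    have := (moebius_mem p σ₁ σ₂ hg r s z.2).2.1
    simp [h] at this
  have hne₂ : ∀ z : Nbhd p σ₁ σ₂ r s, autFactor p σ₂ g z.1.2 ≠ 0 := fun z h => by
    have := (moebius_mem p σ₁ σ₂ hg r s z.2).2.2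
    simp [h] at this
  have c₁ : Continuous fun z : Nbhd p σ₁ σ₂ r s => autFactor p σ₁ g z.1.1 := by
    unfold autFactor; fun_prop
  have c₂ : Continuous fun z : Nbhd p σ₁ σ₂ r s => autFactor p σ₂ g z.1.2 := by
    unfold autFactor; fun_prop
  have m₁ : Continuous fun z : Nbhd p σ₁ σ₂ r s => moebius p σ₁ g z.1.1 := by
    unfold moebius
    exact Continuous.div (by fun_prop) c₁ hne₁
  have m₂ : Continuous fun z : Nbhd p σ₁ σ₂ r s => moebius p σ₂ g z.1.2 := by
    unfold moebius
    exact Continuous.div (by fun_prop) c₂ hne₂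
  exact ((c₁.pow k).mul (c₂.pow k)).mul (hF.comp (Continuous.subtype_mk (m₁.prodMk m₂) _))

theorem isRigid_weightFun (σ₁ σ₂ : K →+* L) (k : ℕ) {g : GL (Fin 2) K}
    (hg : IsSigmaZero p σ₁ σ₂ g) (r s : Radius) {F : Nbhd p σ₁ σ₂ r s → ℂ_[p]}
    (hF : IsRigid p σ₁ σ₂ r s F) : IsRigid p σ₁ σ₂ r s (weightFun p σ₁ σ₂ k hg r s F) := by
  intro u
  have : IsUltrametricDist L := IsUltrametricDist.of_normedAlgebra ℚ_[p]
  obtain ⟨m, h0, h1, h2⟩ := id hg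
  obtain ⟨α, κ, δ, hα, hκ, hδ, H⟩ := moebius_local p σ₁ g m h0 h1 (fun i j => (h2 i j).1) u
  obtain ⟨α', κ', δ', hα', hκ', hδ', H'⟩ := moebius_local p σ₂ g m h0 h1 (fun i j => (h2 i j).2) u
  obtain ⟨a, ha, haF⟩ := hF ((m 0 1 + m 1 1 * u) * Ring.inverse (m 0 0 + m 1 0 * u))
  have hp0 : (0 : ℝ) ≤ (p : ℝ)⁻¹ := by positivity
  have hp1 : (p : ℝ)⁻¹ < 1 :=
    inv_lt_one_of_one_lt₀ (by exact_mod_cast (Fact.out : p.Prime).one_lt)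
  have hU : ∀ α κ δ : L, ‖α‖ = 1 → ‖κ‖ ≤ (p : ℝ)⁻¹ → ‖δ‖ ≤ 1 → ∀ i : ℕ,
      UnitSeries L (p : ℝ)⁻¹ (fun t : ℂ_[p] =>
        ((algebraMap L ℂ_[p] δ + algebraMap L ℂ_[p] 0 * t) ^ i *
          (algebraMap L ℂ_[p] α + algebraMap L ℂ_[p] κ * t) ^ k) *
          ((algebraMap L ℂ_[p] α + algebraMap L ℂ_[p] κ * t)⁻¹) ^ i) := by
    intro α κ δ hα hκ hδ i
    exact (((UnitSeries.linear hp0 δ 0 hδ (by simp)).pow hp0 i).mul hp0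
      ((UnitSeries.linear hp0 α κ hα.le hκ).pow hp0 k)).mul hp0
      ((UnitSeries.inv hp1 α κ hα hκ).pow hp0 i)
  obtain ⟨b, hb, hbS⟩ := series_compose hp0 hp1 r.2.1 r.2.2 s.2.1 s.2.2
    (hU α κ δ hα hκ hδ) (hU α' κ' δ' hα' hκ' hδ') ha
  refine ⟨b, hb, fun z hz₁ hz₂ => hbS _ _ _ hz₁ hz₂ ?_⟩
  obtain ⟨na, ea, eb⟩ := H z.1.1 (hz₁.trans r.2.2)
  obtain ⟨na', ea', eb'⟩ := H' z.1.2 (hz₂.trans s.2.2)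
  have hF1 := haF ⟨(moebius p σ₁ g z.1.1, moebius p σ₂ g z.1.2),
    (moebius_mem p σ₁ σ₂ hg r s z.2).1⟩
    (by
      simp only []
      rw [eb, norm_mul, norm_mul, norm_inv, na, inv_one, mul_one, norm_algebraMap']
      exact (mul_le_of_le_one_left (norm_nonneg _) hδ).trans hz₁)
    (by
      simp only []
      rw [eb', norm_mul, norm_mul, norm_inv, na', inv_one, mul_one, norm_algebraMap']
      exact (mul_le_of_le_one_left (norm_nonneg _) hδ').trans hz₂)
  have hF2 := hF1.mul_left (autFactor p σ₁ g z.1.1 ^ k * autFactor p σ₂ g z.1.2 ^ k)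
  refine (congrArg (HasSum · _) (funext fun j => ?_)).mp hF2
  simp only [eb, eb', map_zero, zero_mul, add_zero, ← ea, ← ea', mul_pow]
  ring

/-- The left weight `(k, k)` action of `g` on `𝔸[L, r, s]`. -/
noncomputable def weightAct (σ₁ σ₂ : K →+* L) (k : ℕ) {g : GL (Fin 2) K}
    (hg : IsSigmaZero p σ₁ σ₂ g) (r s : Radius) :
    RigidFun p σ₁ σ₂ r s →L[L] RigidFun p σ₁ σ₂ r s :=
  LinearMap.mkContinuous
    { toFun := fun F => ⟨BoundedContinuousFunction.ofNormedAddCommGroup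
        (weightFun p σ₁ σ₂ k hg r s F.1) (continuous_weightFun p σ₁ σ₂ k hg r s F.1.continuous)
        ‖F.1‖ (fun z => (norm_weightFun p σ₁ σ₂ k hg r s F.1 z).le.trans (F.1.norm_coe_le_norm _)),
        isRigid_weightFun p σ₁ σ₂ k hg r s F.2⟩
      map_add' := fun F G => by
        apply Subtype.ext; apply BoundedContinuousFunction.ext; intro z
        simp [weightFun, mul_add]
      map_smul' := fun c F => by
        apply Subtype.ext; apply BoundedContinuousFunction.ext; intro z
        simp [weightFun] }
    1 (fun F => by
      rw [one_mul]
      exact BoundedContinuousFunction.norm_ofNormedAddCommGroup_le _ (norm_nonneg _)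
        (fun z => (norm_weightFun p σ₁ σ₂ k hg r s F.1 z).le.trans (F.1.norm_coe_le_norm _)))

/-- The right weight `(k, k)` action `μ ↦ μ|ₖ g` on distributions, `(μ|ₖ g)(F) = μ(g ·ₖ F)`. -/
noncomputable def slash (σ₁ σ₂ : K →+* L) (k : ℕ) {g : GL (Fin 2) K}
    (hg : IsSigmaZero p σ₁ σ₂ g) (μ : LocDist p σ₁ σ₂) : LocDist p σ₁ σ₂ :=
  ⟨fun ρ => (μ.1 ρ).comp (weightAct p σ₁ σ₂ k hg ρ.1 ρ.2), fun ρ ρ' h F =>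
    μ.2 ρ ρ' h (weightAct p σ₁ σ₂ k hg ρ'.1 ρ'.2 F)⟩


/-- The upper triangular matrix `(1, a; 0, β)` with `a, β ∈ 𝓞_K`, `β ≠ 0`. -/
noncomputable def heckeMat {K : Type*} [Field K] (a β : 𝓞 K) (hβ : β ≠ 0) : GL (Fin 2) K :=
  Matrix.GeneralLinearGroup.mkOfDetNeZero !![1, (a : K); 0, (β : K)] (by
    simpa [Matrix.det_fin_two_of] using hβ)

theorem coe_heckeMat {K : Type*} [Field K] (a β : 𝓞 K) (hβ : β ≠ 0) :
    ((heckeMat a β hβ : GL (Fin 2) K) : Matrix (Fin 2) (Fin 2) K) = !![1, (a : K); 0, (β : K)] :=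
  rfl

theorem isSigmaZero_heckeMat (σ₁ σ₂ : K →+* L) (a β : 𝓞 K) (hβ : β ≠ 0) :
    IsSigmaZero p σ₁ σ₂ (heckeMat a β hβ) := by
  refine ⟨!![1, 1 ⊗ₜ a; 0, 1 ⊗ₜ β], by simp, by simp, fun i j => ?_⟩
  rw [coe_heckeMat]
  fin_cases i <;> fin_cases j <;> simp [localEmb_one_tmul]

open scoped nonZeroDivisors in
/-- The twist `Γ_I` of `Γ₁(𝔫)`: the matrices `(a, b; c, d)` in `SL₂(K)` with `a, d ∈ 1 + 𝔫`,
`b ∈ I` and `c ∈ 𝔫 I⁻¹`. -/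
def twistedGamma (K : Type*) [Field K] [NumberField K] (n I : Ideal (𝓞 K)) :
    Subgroup (Matrix.SpecialLinearGroup (Fin 2) K) where
  carrier := {g | g 0 0 - 1 ∈ (n : FractionalIdeal (𝓞 K)⁰ K) ∧
    g 1 1 - 1 ∈ (n : FractionalIdeal (𝓞 K)⁰ K) ∧
    g 0 1 ∈ (I : FractionalIdeal (𝓞 K)⁰ K) ∧
    g 1 0 ∈ (n : FractionalIdeal (𝓞 K)⁰ K) * (I : FractionalIdeal (𝓞 K)⁰ K)⁻¹}
  one_mem' := by simp [FractionalIdeal.zero_mem]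
  mul_mem' := by
    rintro g g' ⟨ha, hd, hb, hc⟩ ⟨ha', hd', hb', hc'⟩
    have hbc : ∀ x ∈ (I : FractionalIdeal (𝓞 K)⁰ K),
        ∀ y ∈ (n : FractionalIdeal (𝓞 K)⁰ K) * (I : FractionalIdeal (𝓞 K)⁰ K)⁻¹,
        x * y ∈ (n : FractionalIdeal (𝓞 K)⁰ K) := by
      intro x hx y hy
      by_cases hI : I = ⊥
      · subst hI
        have : x = 0 := by simpa using hx
        simp [this, FractionalIdeal.zero_mem]
      · have h := FractionalIdeal.mul_mem_mul hx hy
        rwa [mul_left_comm, mul_inv_cancel₀ (by simpa using hI), mul_one] at h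
    have hint : ∀ J : FractionalIdeal (𝓞 K)⁰ K, ∀ x y : K, x - 1 ∈ (n : FractionalIdeal (𝓞 K)⁰ K) →
        y ∈ J → x * y ∈ J := by
      intro J x y hx hy
      obtain ⟨w, -, hw⟩ := (FractionalIdeal.mem_coeIdeal _).1 hx
      have : x = algebraMap (𝓞 K) K (w + 1) := by rw [map_add, hw, map_one]; ring
      rw [this, ← Algebra.smul_def]
      exact J.1.smul_mem _ hy
    have hadd : ∀ J : FractionalIdeal (𝓞 K)⁰ K, ∀ x y : K, x ∈ J → y ∈ J → x + y ∈ J :=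
      fun J _ _ hx hy => J.1.add_mem hx hy
    refine ⟨?_, ?_, ?_, ?_⟩
    · have e : (g * g') 0 0 - 1 = g 0 0 * (g' 0 0 - 1) + (g 0 0 - 1) + g 0 1 * g' 1 0 := by
        simp [Matrix.mul_apply, Fin.sum_univ_two]; ring
      rw [e]
      exact hadd _ _ _ (hadd _ _ _ (hint _ _ _ ha ha') ha) (hbc _ hb _ hc')
    · have e : (g * g') 1 1 - 1 = g 1 1 * (g' 1 1 - 1) + (g 1 1 - 1) + g' 0 1 * g 1 0 := by
        simp [Matrix.mul_apply, Fin.sum_univ_two]; ring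
      rw [e]
      exact hadd _ _ _ (hadd _ _ _ (hint _ _ _ hd hd') hd) (hbc _ hb' _ hc)
    · have e : (g * g') 0 1 = g 0 0 * g' 0 1 + g' 1 1 * g 0 1 := by
        simp [Matrix.mul_apply, Fin.sum_univ_two]; ring
      rw [e]
      exact hadd _ _ _ (hint _ _ _ ha hb') (hint _ _ _ hd' hb)
    · have e : (g * g') 1 0 = g' 0 0 * g 1 0 + g 1 1 * g' 1 0 := by
        simp [Matrix.mul_apply, Fin.sum_univ_two]; ring
      rw [e]
      exact hadd _ _ _ (hint _ _ _ ha' hc) (hint _ _ _ hd hc')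
  inv_mem' := by
    rintro g ⟨ha, hd, hb, hc⟩
    rw [Matrix.SpecialLinearGroup.SL2_inv_expl]
    exact ⟨hd, ha, (I : FractionalIdeal (𝓞 K)⁰ K).1.neg_mem hb,
      ((n : FractionalIdeal (𝓞 K)⁰ K) * (I : FractionalIdeal (𝓞 K)⁰ K)⁻¹).1.neg_mem hc⟩

open scoped nonZeroDivisors in
theorem isSigmaZero_of_mem_twistedGamma [NumberField K] (σ₁ σ₂ : K →+* L) {n I : Ideal (𝓞 K)}
    (hpn : Ideal.span {(p : 𝓞 K)} ∣ n) (hI : IsCoprime I n)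
    {γ : Matrix.SpecialLinearGroup (Fin 2) K} (hγ : γ ∈ twistedGamma K n I) :
    IsSigmaZero p σ₁ σ₂ (γ : GL (Fin 2) K) := by
  obtain ⟨ha, hd, hb, hc⟩ := hγ
  obtain ⟨a, han, ha⟩ := (FractionalIdeal.mem_coeIdeal _).1 ha
  obtain ⟨d, hdn, hd⟩ := (FractionalIdeal.mem_coeIdeal _).1 hd
  obtain ⟨b, hbI, hb⟩ := (FractionalIdeal.mem_coeIdeal _).1 hb
  obtain ⟨i, hi, z, hz, hiz⟩ := Ideal.isCoprime_iff_exists.1 hI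
  have hp : ∀ x ∈ n, (p : LocalIntegers p K) ∣ 1 ⊗ₜ x := by
    intro x hx
    obtain ⟨y, rfl⟩ := Ideal.mem_span_singleton.1 (Ideal.dvd_iff_le.1 hpn hx)
    refine ⟨1 ⊗ₜ y, ?_⟩
    have : (p : LocalIntegers p K) = 1 ⊗ₜ (p : 𝓞 K) := by
      rw [← map_natCast (Algebra.TensorProduct.includeRight : 𝓞 K →ₐ[ℤ] ℤ_[p] ⊗[ℤ] 𝓞 K)]
      rfl
    rw [this, Algebra.TensorProduct.tmul_mul_tmul, one_mul]
  have hu : ∀ x y : 𝓞 K, x ∈ n → y = 1 + x → IsUnit (1 ⊗ₜ y : LocalIntegers p K) := by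
    rintro x y hx rfl
    rw [TensorProduct.tmul_add]
    exact isUnit_add_of_dvd p K isUnit_one (hp x hx)
  have hiu : IsUnit (1 ⊗ₜ i : LocalIntegers p K) :=
    hu (-z) i (neg_mem hz) (by rw [← hiz]; ring)
  have hci : γ 1 0 * i ∈ (n : FractionalIdeal (𝓞 K)⁰ K) := by
    by_cases hI0 : I = ⊥
    · subst hI0
      have : i = 0 := by simpa using hi
      simp [this, FractionalIdeal.zero_mem]
    · have h := FractionalIdeal.mul_mem_mul hc ((FractionalIdeal.mem_coeIdeal_of_mem (𝓞 K)⁰ hi))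
      rwa [mul_assoc, inv_mul_cancel₀ (by simpa using hI0), mul_one] at h
  obtain ⟨c, hcn, hc⟩ := (FractionalIdeal.mem_coeIdeal _).1 hci
  have hlast : ∀ σ : K →+* L,
      localEmb p σ (1 ⊗ₜ c * Ring.inverse (1 ⊗ₜ i)) = σ (γ 1 0) := by
    intro σ
    have h1 : localEmb p σ (1 ⊗ₜ i) * localEmb p σ (Ring.inverse (1 ⊗ₜ i)) = 1 := by
      rw [← map_mul, Ring.mul_inverse_cancel _ hiu, map_one]
    have h2 : localEmb p σ (1 ⊗ₜ c) = σ (γ 1 0) * localEmb p σ (1 ⊗ₜ i) := by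
      rw [localEmb_one_tmul, localEmb_one_tmul, ← map_mul]
      exact congrArg σ hc
    rw [map_mul, h2, mul_assoc, h1, mul_one]
  have ha' : γ 0 0 = algebraMap (𝓞 K) K (1 + a) := by
    rw [map_add, ha, map_one]; ring
  have hd' : γ 1 1 = algebraMap (𝓞 K) K (1 + d) := by
    rw [map_add, hd, map_one]; ring
  refine ⟨!![1 ⊗ₜ (1 + a), 1 ⊗ₜ b; 1 ⊗ₜ c * Ring.inverse (1 ⊗ₜ i), 1 ⊗ₜ (1 + d)],
    hu a _ han rfl, (hp c hcn).mul_right _, fun j l => ?_⟩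
  have key : ∀ σ : K →+* L, localEmb p σ (!![1 ⊗ₜ (1 + a), 1 ⊗ₜ b;
      1 ⊗ₜ c * Ring.inverse (1 ⊗ₜ i), 1 ⊗ₜ (1 + d)] j l) = σ (γ j l) := by
    intro σ
    fin_cases j <;> fin_cases l
    · simpa [localEmb_one_tmul] using congrArg σ ha'.symm
    · simpa [localEmb_one_tmul] using congrArg σ hb
    · simpa using hlast σ
    · simpa [localEmb_one_tmul] using congrArg σ hd'.symm
  exact ⟨key σ₁, key σ₂⟩

/-- `Δ₀ = Div⁰(ℙ¹(K))`. -/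
noncomputable def Div0 (K : Type*) [Field K] : AddSubgroup (OnePoint K →₀ ℤ) :=
  (Finsupp.degree : (OnePoint K →₀ ℤ) →+ ℤ).ker

open Classical in
/-- The left action of `GL₂(K)` on `Δ₀` by fractional linear transformations. -/
noncomputable def Div0.act {K : Type*} [Field K] (g : GL (Fin 2) K) (D : Div0 K) : Div0 K :=
  ⟨Finsupp.mapDomain (g • ·) D.1, by
    have h : Finsupp.degree D.1 = 0 := D.2
    change Finsupp.degree _ = 0
    rw [Finsupp.degree_mapDomain, h]⟩

/-- The space `Symb_Γ(𝒟_{k,k}(L))`, for `Γ = Γ_I`, of `Γ`-invariant homomorphisms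
`Δ₀ → 𝒟_{k,k}(L)`. -/
def Symb [NumberField K] (σ₁ σ₂ : K →+* L) (k : ℕ) {n I : Ideal (𝓞 K)}
    (hpn : Ideal.span {(p : 𝓞 K)} ∣ n) (hI : IsCoprime I n) :
    Submodule L (Div0 K →+ LocDist p σ₁ σ₂) where
  carrier := {Ψ | ∀ (γ : Matrix.SpecialLinearGroup (Fin 2) K) (hγ : γ ∈ twistedGamma K n I)
    (D : Div0 K), Ψ D = slash p σ₁ σ₂ k
      (isSigmaZero_of_mem_twistedGamma p σ₁ σ₂ hpn hI hγ) (Ψ (Div0.act (γ : GL (Fin 2) K) D))}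
  zero_mem' := fun _ _ _ => rfl
  add_mem' := fun hΨ hΦ γ hγ D =>
    congrArg₂ (fun μ ν : LocDist p σ₁ σ₂ => μ + ν) (hΨ γ hγ D) (hΦ γ hγ D)
  smul_mem' := fun c _ hΨ γ hγ D =>
    congrArg (fun μ : LocDist p σ₁ σ₂ => c • μ) (hΨ γ hγ D)

/-- `S` is a system of representatives for `𝓞_K` modulo `𝔞`. -/
def IsRepSystem {K : Type*} [Field K] (𝔞 : Ideal (𝓞 K)) (S : Finset (𝓞 K)) : Prop :=
  ∀ x : 𝓞 K, ∃! a, a ∈ S ∧ x - a ∈ 𝔞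

/-- The operator `∑_{a ∈ S} (1, a; 0, β)`, acting by `(Ψ|g)(D) = Ψ(g D)|ₖ g`. For a system of
representatives `S` modulo `(β)` it is the Hecke operator `U_{(β)}`. -/
noncomputable def hecke (σ₁ σ₂ : K →+* L) (k : ℕ) (S : Finset (𝓞 K)) (β : 𝓞 K) (hβ : β ≠ 0)
    (Ψ : Div0 K → LocDist p σ₁ σ₂) (D : Div0 K) : LocDist p σ₁ σ₂ :=
  ∑ a ∈ S, slash p σ₁ σ₂ k (isSigmaZero_heckeMat p σ₁ σ₂ a β hβ) (Ψ (Div0.act (heckeMat a β hβ) D))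

/-- `Ψ` is a `U_{(β)}`-eigensymbol with eigenvalue `c`. -/
def IsEigensymbol (σ₁ σ₂ : K →+* L) (k : ℕ) (S : Finset (𝓞 K)) (β : 𝓞 K) (hβ : β ≠ 0)
    (Ψ : Div0 K →+ LocDist p σ₁ σ₂) (c : L) : Prop :=
  ∀ D : Div0 K, hecke p σ₁ σ₂ k S β hβ Ψ D = c • Ψ D

/-- The valuation on `L`, normalised by `v(p) = 1`. -/
noncomputable def padicVal (p : ℕ) {L : Type*} [NontriviallyNormedField L] (c : L) : ℝ :=
  -Real.logb p ‖c‖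

/-- `μ` is `h`-admissible: `‖μ‖_{r,r} = O(r^{-h})` as `r → 0⁺`. -/
def IsAdmissible {σ₁ σ₂ : K →+* L} (μ : LocDist p σ₁ σ₂) (h : ℝ) : Prop :=
  (fun r : Radius => distNorm p μ r r) =O[comap (fun r : Radius => (r : ℝ)) (𝓝[>] 0)]
    (fun r : Radius => (r : ℝ) ^ (-h))

/-- `μ` is `(h₁, h₂)`-admissible: `‖μ‖_{r,s} = O(r^{-h₁})` as `r → 0⁺`, uniformly for `s` bounded
away from `0`; `‖μ‖_{r,s} = O(s^{-h₂})` as `s → 0⁺`, uniformly for `r` bounded away from `0`;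
and jointly `‖μ‖_{r,s} = O(r^{-h₁} s^{-h₂})`. -/
def IsSplitAdmissible {σ₁ σ₂ : K →+* L} (μ : LocDist p σ₁ σ₂) (h₁ h₂ : ℝ) : Prop :=
  (∀ s₀ : Radius, ∃ C : ℝ, ∀ r s : Radius, s₀ ≤ s → distNorm p μ r s ≤ C * (r : ℝ) ^ (-h₁)) ∧
  (∀ r₀ : Radius, ∃ C : ℝ, ∀ r s : Radius, r₀ ≤ r → distNorm p μ r s ≤ C * (s : ℝ) ^ (-h₂)) ∧
  ∃ C : ℝ, ∀ r s : Radius, distNorm p μ r s ≤ C * ((r : ℝ) ^ (-h₁) * (s : ℝ) ^ (-h₂))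

end Setup


end BianchiSymb

open BianchiSymb

open scoped NumberField

/-! The matrix `(1, a; 0, β)` has automorphy factor 1 and acts on functions through `z ↦ a + βz`,
which maps the neighbourhood of radii `(r', s')` into that of radii `(r, s)` as soon as `|σ₁(β)| r'
≤ r` and `|σ₂(β)| s' ≤ s`. Slashing by it therefore bounds a norm at small radii by a norm at larger
ones (`distNorm_slash_heckeMat_le`). Dividing the eigenvalue equation by the eigenvalue `c` turns a
bound `C` at `(r', s')` into the bound `|c|⁻¹ C` at `(r, s)` (`IsEigensymbol.distNorm_le`).
Iterating along the radii `qᴺ` with `|c| = q ^ h` produces the growth `r ^ (-h)`, and monotonicity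
of the norms in the radii fills the gaps between powers of `q`. In the split case a generator of
`𝔭ᵐ` shrinks the first radius and a generator of the `m`-th power of the conjugate prime shrinks the
second; running the two iterations one after the other gives the joint bound.

Each step of the iteration changes the divisor, so the starting bound must be uniform over all `D`
(`exists_forall_distNorm_le`). The function `D ↦ ‖Ψ(D)‖_{r,s}` is `Γ`-invariant and ultrametric, so
it suffices that finitely many `Γ`-orbits generate `Δ₀`. A continued fraction descent supplies
generators: a difference of two cusps is the pair of columns of an integral matrix, and when its
determinant has large norm the pigeonhole principle finds an intermediate cusp splitting it into two
pairs of smaller determinant (`exists_small_cramer`, `exists_colDiff_generators`). Only finitely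
many determinants of bounded norm occur, because `K` has a single infinite place, and matrices with
equal determinant that agree modulo a fixed nonzero element differ by an element of `Γ`
(`exists_act_colDiff_eq`). No assumption on the class number enters. -/

namespace BianchiSymb

/-! ### Pigeonhole descent for pairs of integral vectors. -/

section Descent

open NumberField Matrix
open scoped NumberField

variable {K : Type*} [Field K] [NumberField K]

/-- An imaginary quadratic field has a single infinite place, whose square is the norm. -/
theorem exists_place_sq_eq_norm [IsTotallyComplex K] (hK : Module.finrank ℚ K = 2) :
    ∃ w : InfinitePlace K, (∀ w' : InfinitePlace K, w' = w) ∧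
      ∀ x : K, w x ^ 2 = |Algebra.norm ℚ x| := by
  have hc : InfinitePlace.nrComplexPlaces K = 1 := by
    have := IsTotallyComplex.finrank K
    omega
  have hcard : Fintype.card (InfinitePlace K) = 1 := by
    rw [InfinitePlace.card_eq_nrRealPlaces_add_nrComplexPlaces, hc,
      IsTotallyComplex.nrRealPlaces_eq_zero K]
  obtain ⟨w, hw⟩ := Fintype.card_eq_one_iff.1 hcard
  refine ⟨w, hw, fun x => ?_⟩
  have h := InfinitePlace.prod_eq_abs_norm x
  rw [Fintype.prod_eq_single w (fun w' hw' => (hw' (hw w')).elim),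
    InfinitePlace.mult_isComplex ⟨w, IsTotallyComplex.isComplex w⟩] at h
  exact_mod_cast h

theorem place_sq_eq_natAbs_norm {w : InfinitePlace K}
    (hw : ∀ x : K, w x ^ 2 = |Algebra.norm ℚ x|) (x : 𝓞 K) :
    w (x : K) ^ 2 = ((Algebra.norm ℤ x).natAbs : ℝ) := by
  rw [hw, ← Algebra.coe_norm_int, Nat.cast_natAbs]
  norm_cast

/-- With only one infinite place, a bound at `w` bounds all complex conjugates, and only finitely
many algebraic integers of `K` have bounded conjugates. -/
theorem finite_setOf_place_le {w : InfinitePlace K} (hw : ∀ w' : InfinitePlace K, w' = w)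
    (B : ℝ) : {x : 𝓞 K | w (x : K) ≤ B}.Finite := by
  refine ((Embeddings.finite_of_norm_le K ℂ B).preimage
    RingOfIntegers.coe_injective.injOn).subset fun x hx => ⟨x.2, fun φ => ?_⟩
  rw [← InfinitePlace.apply, hw (InfinitePlace.mk φ)]
  exact hx

theorem finite_setOf_natAbs_norm_le [IsTotallyComplex K] (hK : Module.finrank ℚ K = 2) (B : ℕ) :
    {x : 𝓞 K | (Algebra.norm ℤ x).natAbs ≤ B}.Finite := by
  obtain ⟨w, hw, hn⟩ := exists_place_sq_eq_norm hK
  refine (finite_setOf_place_le hw √B).subset fun x hx => Real.le_sqrt_of_sq_le ?_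
  rw [place_sq_eq_natAbs_norm hn]
  exact_mod_cast hx

/-- The index of the lattice spanned by the columns of an integral matrix. -/
theorem card_quotient_range_mulVecLin {ι : Type*} [Fintype ι] [DecidableEq ι]
    (M : Matrix ι ι (𝓞 K)) (hM : M.det ≠ 0) :
    Nat.card ((ι → 𝓞 K) ⧸ (M.mulVecLin.restrictScalars ℤ).range) =
      (Algebra.norm ℤ M.det).natAbs := by
  have hinj : Function.Injective (M.mulVecLin.restrictScalars ℤ) :=
    Matrix.mulVec_injective_of_det_ne_zero hM
  rw [← Submodule.natAbs_det_equiv _ (LinearEquiv.ofInjective _ hinj)]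
  have h2 : ((M.mulVecLin.restrictScalars ℤ).range.subtype ∘ₗ AddMonoidHom.toIntLinearMap
      ((LinearEquiv.ofInjective (M.mulVecLin.restrictScalars ℤ) hinj :
        (ι → 𝓞 K) ≃ₗ[ℤ] (M.mulVecLin.restrictScalars ℤ).range) :
        (ι → 𝓞 K) →+ (M.mulVecLin.restrictScalars ℤ).range)) =
      M.mulVecLin.restrictScalars ℤ := by
    ext; rfl
  -- The index is the absolute value of the determinant over `ℤ`, which is the norm of the
  -- determinant over `𝓞 K`.
  rw [h2, LinearMap.det_restrictScalars, ← Matrix.toLin'_apply', LinearMap.det_toLin']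

/-- The triangle inequality in an integral basis, since `w` restricts to the usual absolute value on
`ℚ`. The sum on the right dictates the fineness of the grid in `exists_small_cramer`. -/
theorem place_le_of_abs_repr_le (w : InfinitePlace K) (x : K) {ε : ℝ}
    (hx : ∀ j, |((integralBasis K).repr x j : ℝ)| ≤ ε) :
    w x ≤ ε * ∑ j, w (integralBasis K j) := by
  conv_lhs => rw [← (integralBasis K).sum_repr x]
  rw [Finset.mul_sum]
  refine (Finset.le_sum_of_subadditive w (map_zero w).le (fun x y => w.1.add_le x y) _ _).trans ?_
  refine Finset.sum_le_sum fun j _ => ?_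
  rw [Algebra.smul_def, map_mul]
  refine mul_le_mul_of_nonneg_right ?_ (apply_nonneg w _)
  refine le_trans (le_of_eq ?_) (hx j)
  rw [← InfinitePlace.norm_embedding_eq, eq_ratCast, map_ratCast, ← Complex.ofReal_ratCast,
    Complex.norm_real, Real.norm_eq_abs]

/-- Pigeonhole in `𝓞² / M 𝓞²`: if the determinant of `M` has large norm then some nonzero integral
vector has small coordinates with respect to the columns of `M`. -/
theorem exists_small_cramer (w : InfinitePlace K) :
    ∃ B : ℕ, ∀ M : Matrix (Fin 2) (Fin 2) (𝓞 K), B < (Algebra.norm ℤ M.det).natAbs →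
      ∃ z : Fin 2 → 𝓞 K, z ≠ 0 ∧ ∀ i, w (M.cramer z i : K) < w (M.det : K) := by
  classical
  obtain ⟨T, hT⟩ := exists_nat_gt (∑ j, w (integralBasis K j))
  have hT0 : (0 : ℝ) < T := lt_of_le_of_lt (Finset.sum_nonneg fun j _ => apply_nonneg w _) hT
  let ι := Module.Free.ChooseBasisIndex ℤ (𝓞 K)
  refine ⟨Nat.card (Fin 2 × ι → Fin T), fun M hM => ?_⟩
  have hd : M.det ≠ 0 := by rintro h; simp [h] at hM
  have hdK : (M.det : K) ≠ 0 := by simpa using hd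
  rw [← card_quotient_range_mulVecLin M hd] at hM
  set N := (M.mulVecLin.restrictScalars ℤ).range
  -- By Cramer's rule these are the rational coordinates of `M⁻¹ z`.
  let t : (Fin 2 → 𝓞 K) → Fin 2 × ι → ℚ :=
    fun z i => (integralBasis K).repr ((M.cramer z i.1 : K) / (M.det : K)) i.2
  have hfl : ∀ z i, ⌊(T : ℚ) * Int.fract (t z i)⌋₊ < T := fun z i => by
    have hTq : (0 : ℚ) < T := by exact_mod_cast hT0
    rw [Nat.floor_lt (mul_nonneg hTq.le (Int.fract_nonneg _))]
    exact mul_lt_of_lt_one_right hTq (Int.fract_lt_one _)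
  -- Each class is sent to the grid box of side `1 / T` containing the fractional parts of its
  -- coordinates; there are `|N(det M)|` classes, more than there are boxes.
  let f : ((Fin 2 → 𝓞 K) ⧸ N) → (Fin 2 × ι → Fin T) := fun q i =>
    ⟨⌊(T : ℚ) * Int.fract (t q.out i)⌋₊, hfl _ _⟩
  have hninj : ¬ Function.Injective f := fun hf =>
    (Nat.card_le_card_of_injective f hf).not_gt hM
  simp only [Function.Injective, not_forall] at hninj
  obtain ⟨q, q', hqq, hne⟩ := hninj
  let n : Fin 2 × ι → ℤ := fun i => ⌊t q.out i⌋ - ⌊t q'.out i⌋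
  -- Subtracting `M e` removes the integral parts without leaving the class modulo `N`, so the
  -- result is nonzero because `q ≠ q'`.
  let e : Fin 2 → 𝓞 K := fun i => ∑ j, n (i, j) • RingOfIntegers.basis K j
  refine ⟨q.out - q'.out - M *ᵥ e, fun hz => hne ?_, fun i => ?_⟩
  · rw [← Submodule.Quotient.mk_out q, ← Submodule.Quotient.mk_out q', Submodule.Quotient.eq,
      sub_eq_zero.1 hz]
    exact ⟨e, rfl⟩
  · have hcr : M.cramer (q.out - q'.out - M *ᵥ e) i =
        M.cramer q.out i - M.cramer q'.out i - M.det * e i := by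
      rw [map_sub, map_sub, cramer_eq_adjugate_mulVec M (M *ᵥ e), mulVec_mulVec, adjugate_mul,
        smul_mulVec, one_mulVec]
      rfl
    have hrepr : ∀ j, (integralBasis K).repr
        ((M.cramer (q.out - q'.out - M *ᵥ e) i : K) / (M.det : K)) j =
        Int.fract (t q.out (i, j)) - Int.fract (t q'.out (i, j)) := by
      intro j
      have he : (integralBasis K).repr (e i : K) j = n (i, j) := by
        rw [integralBasis_repr_apply]
        simp only [e]
        rw [(RingOfIntegers.basis K).repr_sum_self, eq_intCast]
      have : (M.cramer (q.out - q'.out - M *ᵥ e) i : K) / (M.det : K) =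
          (M.cramer q.out i : K) / (M.det : K) - (M.cramer q'.out i : K) / (M.det : K)
            - (e i : K) := by
        rw [hcr]; push_cast; field_simp
      rw [this, map_sub, map_sub, Finsupp.sub_apply, Finsupp.sub_apply, he]
      simp only [n, t, Int.fract]
      push_cast
      ring
    have hlt := place_le_of_abs_repr_le w
      ((M.cramer (q.out - q'.out - M *ᵥ e) i : K) / (M.det : K)) (ε := (T : ℝ)⁻¹) (fun j => by
        rw [hrepr]
        have h1 := congrArg Fin.val (congrFun hqq (i, j))
        have hTq : (0 : ℚ) < T := by exact_mod_cast hT0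
        have h2 : ⌊(T : ℚ) * Int.fract (t q.out (i, j))⌋ =
            ⌊(T : ℚ) * Int.fract (t q'.out (i, j))⌋ := by
          rw [← Int.natCast_floor_eq_floor (mul_nonneg hTq.le (Int.fract_nonneg _)),
            ← Int.natCast_floor_eq_floor (mul_nonneg hTq.le (Int.fract_nonneg _))]
          exact_mod_cast h1
        have h3 := Int.abs_sub_lt_one_of_floor_eq_floor h2
        rw [← mul_sub, abs_mul, abs_of_pos hTq, mul_comm, ← lt_div_iff₀ hTq, one_div] at h3
        have h4 := (Rat.cast_le (K := ℝ)).2 h3.le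
        push_cast at h4 ⊢
        exact h4)
    have hlt2 : (T : ℝ)⁻¹ * ∑ j, w (integralBasis K j) < 1 := by
      rw [inv_mul_lt_iff₀ hT0, mul_one]; exact hT
    have h3 := hlt.trans_lt hlt2
    rw [map_div₀, div_lt_one (InfinitePlace.pos_iff.2 hdK)] at h3
    exact h3

end Descent

/-! ### Generators of `Δ₀` and finiteness modulo `Γ`. -/

section Generators

open NumberField Matrix
open scoped NumberField

variable {K : Type*} [Field K]

open Classical in
/-- The cusp `v₀ / v₁` of `ℙ¹(K)`. -/
noncomputable def cusp (v : Fin 2 → 𝓞 K) : OnePoint K :=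
  if v 1 = 0 then OnePoint.infty else ((v 0 : K) / (v 1 : K) : K)

/-- The divisor `{x} - {y}`. -/
noncomputable def cuspDiff (x y : OnePoint K) : Div0 K :=
  ⟨Finsupp.single x 1 - Finsupp.single y 1, by
    change Finsupp.degree _ = 0
    rw [map_sub, Finsupp.degree_single, Finsupp.degree_single, sub_self]⟩

theorem cuspDiff_self (x : OnePoint K) : cuspDiff x x = 0 :=
  Subtype.ext (sub_self _)

theorem cuspDiff_add (x y z : OnePoint K) : cuspDiff x y + cuspDiff y z = cuspDiff x z :=
  Subtype.ext (sub_add_sub_cancel _ _ _)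

open Classical in
theorem act_cuspDiff (g : GL (Fin 2) K) (x y : OnePoint K) :
    Div0.act g (cuspDiff x y) = cuspDiff (g • x) (g • y) := by
  apply Subtype.ext
  change Finsupp.mapDomain (g • ·) (Finsupp.single x 1 - Finsupp.single y 1) = _
  rw [sub_eq_add_neg, ← Finsupp.single_neg, Finsupp.mapDomain_add, Finsupp.mapDomain_single,
    Finsupp.mapDomain_single, Finsupp.single_neg, ← sub_eq_add_neg]
  rfl

theorem Div0.act_inv_act (g : GL (Fin 2) K) (D : Div0 K) :
    Div0.act g⁻¹ (Div0.act g D) = D := by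
  classical
  apply Subtype.ext
  change Finsupp.mapDomain (g⁻¹ • ·) (Finsupp.mapDomain (g • ·) D.1) = D.1
  rw [← Finsupp.mapDomain_comp]
  convert Finsupp.mapDomain_id
  funext x
  exact inv_smul_smul g x

/-- In degree zero, `∑ m x = ∑ m (x - ∞)`, because the multiples of `∞` cancel. -/
theorem Div0.eq_top_of_cuspDiff_mem {A : AddSubgroup (Div0 K)}
    (hA : ∀ x y, cuspDiff x y ∈ A) : A = ⊤ := by
  refine eq_top_iff.2 fun D _ => ?_
  have hD : D = D.1.sum fun x m => m • cuspDiff x OnePoint.infty := by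
    apply Subtype.ext
    have h0 : D.1.sum (fun _ m => m) = 0 := D.2
    have h1 : ∀ x : OnePoint K, ∀ m : ℤ, ((m • cuspDiff x OnePoint.infty : Div0 K) :
        OnePoint K →₀ ℤ) = Finsupp.single x m - Finsupp.single OnePoint.infty m := by
      intro x m
      rw [AddSubgroup.coe_zsmul]
      simp [cuspDiff, smul_sub]
    have h2 : D.1.sum (fun _ m => Finsupp.single (OnePoint.infty : OnePoint K) m) = 0 := by
      rw [Finsupp.sum, ← Finsupp.single_finsetSum]
      exact (congrArg _ h0).trans (Finsupp.single_zero _)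
    rw [Finsupp.sum, AddSubgroup.val_finsetSum]
    simp only [h1, Finset.sum_sub_distrib]
    rw [Finsupp.sum] at h2
    rw [h2, sub_zero]
    exact (Finsupp.sum_single D.1).symm
  rw [hD]
  exact AddSubgroup.sum_mem _ fun x _ => A.zsmul_mem (hA _ _) _

/-- Proportional nonzero columns define the same point. Nonvanishing is essential: `cusp` assigns
`∞` to the zero vector, which is proportional to everything. -/
theorem cusp_eq_of_det_eq_zero {M : Matrix (Fin 2) (Fin 2) (𝓞 K)} (h0 : M.col 0 ≠ 0)
    (h1 : M.col 1 ≠ 0) (hM : M.det = 0) : cusp (M.col 0) = cusp (M.col 1) := by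
  rw [det_fin_two] at hM
  have h0' : ¬ (M 0 0 = 0 ∧ M 1 0 = 0) := fun h => h0 (by ext i; fin_cases i <;> simp [h])
  have h1' : ¬ (M 0 1 = 0 ∧ M 1 1 = 0) := fun h => h1 (by ext i; fin_cases i <;> simp [h])
  simp only [cusp, col_apply]
  by_cases ha : M 1 0 = 0
  · have : M 1 1 = 0 := by
      by_contra hb
      simp_all
    simp [ha, this]
  · have hb : M 1 1 ≠ 0 := by
      intro hb
      simp_all
    have hM' : (M 0 0 : K) * M 1 1 = M 0 1 * M 1 0 := by
      exact_mod_cast congrArg (algebraMap (𝓞 K) K) (sub_eq_zero.1 hM)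
    have ha' : (M 1 0 : K) ≠ 0 := by simpa using ha
    have hb' : (M 1 1 : K) ≠ 0 := by simpa using hb
    refine (if_neg ha).trans (Eq.trans ?_ (if_neg hb).symm)
    rw [(div_eq_div_iff ha' hb').2 hM']

theorem exists_cusp_eq [NumberField K] (x : OnePoint K) :
    ∃ v : Fin 2 → 𝓞 K, v ≠ 0 ∧ cusp v = x := by
  induction x with
  | infty => exact ⟨![1, 0], fun h => by simpa using congrFun h 0, by simp [cusp]⟩
  | coe x =>
    obtain ⟨a, b, hb, rfl⟩ := IsFractionRing.div_surjective (A := 𝓞 K) x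
    have hb0 : b ≠ 0 := nonZeroDivisors.ne_zero hb
    exact ⟨![a, b], fun h => hb0 (by simpa using congrFun h 1), by simp [cusp, hb0]⟩

open Classical in
theorem smul_cusp (G : SpecialLinearGroup (Fin 2) (𝓞 K)) {v : Fin 2 → 𝓞 K} (hv : v ≠ 0) :
    (SpecialLinearGroup.map (algebraMap (𝓞 K) K) G : GL (Fin 2) K) • cusp v =
      cusp (G.1 *ᵥ v) := by
  have e : ∀ i j, (SpecialLinearGroup.map (algebraMap (𝓞 K) K) G : GL (Fin 2) K) i j =
    (G.1 i j : K) := fun i j => rfl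
  have m0 : (G.1 *ᵥ v) 0 = G.1 0 0 * v 0 + G.1 0 1 * v 1 := by
    simp [mulVec, dotProduct, Fin.sum_univ_two]
  have m1 : (G.1 *ᵥ v) 1 = G.1 1 0 * v 0 + G.1 1 1 * v 1 := by
    simp [mulVec, dotProduct, Fin.sum_univ_two]
  by_cases h1 : v 1 = 0
  · have h0 : v 0 ≠ 0 := fun h0 => hv (by ext i; fin_cases i <;> simp [h0, h1])
    have h0' : (v 0 : K) ≠ 0 := by simpa using h0
    have hc : cusp v = OnePoint.infty := by simp [cusp, h1]
    rw [hc, OnePoint.smul_infty_eq_ite, cusp, m0, m1, e, e]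
    simp only [h1, mul_zero, add_zero, mul_eq_zero, h0, or_false]
    by_cases hG : G.1 1 0 = 0
    · simp [hG]
    · have hG' : (G.1 1 0 : K) ≠ 0 := by simpa using hG
      rw [if_neg hG', if_neg hG]
      congr 1
      push_cast
      field_simp
  · have h1' : (v 1 : K) ≠ 0 := by simpa using h1
    have hc : cusp v = ((v 0 : K) / (v 1 : K) : K) := by simp [cusp, h1]
    have hkey : (G.1 1 0 : K) * ((v 0 : K) / v 1) + G.1 1 1 =
        ((G.1 1 0 * v 0 + G.1 1 1 * v 1 : 𝓞 K) : K) / v 1 := by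
      push_cast; field_simp
    have hkey' : (G.1 0 0 : K) * ((v 0 : K) / v 1) + G.1 0 1 =
        ((G.1 0 0 * v 0 + G.1 0 1 * v 1 : 𝓞 K) : K) / v 1 := by
      push_cast; field_simp
    rw [hc, OnePoint.smul_some_eq_ite, cusp, m0, m1, e, e, e, e, hkey, hkey']
    by_cases hG : G.1 1 0 * v 0 + G.1 1 1 * v 1 = 0
    · simp [hG]
    · rw [if_neg hG, if_neg (div_ne_zero (RingOfIntegers.coe_ne_zero_iff.2 hG) h1'), div_div_div_cancel_right₀ h1']

/-- The divisor `{x} - {y}` of the columns `x`, `y` of an integral matrix. -/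
noncomputable def colDiff (M : Matrix (Fin 2) (Fin 2) (𝓞 K)) : Div0 K :=
  cuspDiff (cusp (M.col 0)) (cusp (M.col 1))

theorem act_colDiff (G : SpecialLinearGroup (Fin 2) (𝓞 K)) {M : Matrix (Fin 2) (Fin 2) (𝓞 K)}
    (hM : M.det ≠ 0) :
    Div0.act (SpecialLinearGroup.map (algebraMap (𝓞 K) K) G : GL (Fin 2) K) (colDiff M) =
      colDiff (G.1 * M) := by
  have hc : ∀ i, M.col i ≠ 0 := fun i h => hM (det_eq_zero_of_column_eq_zero i fun j =>
    congrFun h j)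
  rw [colDiff, act_cuspDiff, smul_cusp G (hc 0), smul_cusp G (hc 1)]
  rfl

variable [NumberField K]

/-- `Div⁰(ℙ¹(K))` is generated by the divisors attached to matrices of bounded determinant. -/
theorem exists_colDiff_generators [IsTotallyComplex K] (hK : Module.finrank ℚ K = 2) :
    ∃ B : ℕ, ∀ A : AddSubgroup (Div0 K), (∀ M : Matrix (Fin 2) (Fin 2) (𝓞 K), M.det ≠ 0 →
      (Algebra.norm ℤ M.det).natAbs ≤ B → colDiff M ∈ A) → A = ⊤ := by
  obtain ⟨w, hw, hn⟩ := exists_place_sq_eq_norm hK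
  obtain ⟨B, hB⟩ := exists_small_cramer w
  refine ⟨B, fun A hA => Div0.eq_top_of_cuspDiff_mem fun x y => ?_⟩
  -- Singular matrices are admitted because the vector produced by the descent may be proportional
  -- to a column.
  have main : ∀ (N : ℕ) (M : Matrix (Fin 2) (Fin 2) (𝓞 K)), (Algebra.norm ℤ M.det).natAbs ≤ N →
      M.col 0 ≠ 0 → M.col 1 ≠ 0 → colDiff M ∈ A := by
    intro N
    induction N using Nat.strong_induction_on with
    | _ N ih =>
      intro M hMN h0 h1
      by_cases hd : M.det = 0
      · rw [colDiff, cusp_eq_of_det_eq_zero h0 h1 hd, cuspDiff_self]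
        exact A.zero_mem
      by_cases hMB : (Algebra.norm ℤ M.det).natAbs ≤ B
      · exact hA M hd hMB
      -- `M.cramer z i` is the determinant after replacing column `i` by `z`, so both replacements
      -- have determinant of smaller norm.
      obtain ⟨z, hz, hlt⟩ := hB M (not_le.1 hMB)
      have hlt' : ∀ i, (Algebra.norm ℤ (M.cramer z i)).natAbs < N := fun i => by
        refine lt_of_lt_of_le ?_ hMN
        have := pow_lt_pow_left₀ (hlt i) (apply_nonneg w _) two_ne_zero
        rw [place_sq_eq_natAbs_norm hn, place_sq_eq_natAbs_norm hn] at this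
        exact_mod_cast this
      have c0 : (M.updateCol 0 z).col 0 = z := by ext i; simp
      have c1 : (M.updateCol 1 z).col 1 = z := by ext i; simp
      have c2 : (M.updateCol 1 z).col 0 = M.col 0 := by ext i; simp
      have c3 : (M.updateCol 0 z).col 1 = M.col 1 := by ext i; simp
      have e1 := ih _ (hlt' 1) (M.updateCol 1 z) (by rw [cramer_apply])
        (by rwa [c2]) (by rwa [c1])
      have e0 := ih _ (hlt' 0) (M.updateCol 0 z) (by rw [cramer_apply])
        (by rwa [c0]) (by rwa [c3])
      -- For columns `x`, `y` this is `({x} - {z}) + ({z} - {y}) = {x} - {y}`.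
      have := A.add_mem e1 e0
      rwa [colDiff, colDiff, c0, c1, c2, c3, cuspDiff_add] at this
  obtain ⟨v, hv, rfl⟩ := exists_cusp_eq x
  obtain ⟨v', hv', rfl⟩ := exists_cusp_eq y
  have h0 : (!![v 0, v' 0; v 1, v' 1]).col 0 = v := by ext i; fin_cases i <;> rfl
  have h1 : (!![v 0, v' 0; v 1, v' 1]).col 1 = v' := by ext i; fin_cases i <;> rfl
  have := main _ !![v 0, v' 0; v 1, v' 1] le_rfl (h0 ▸ hv) (h1 ▸ hv')
  rwa [colDiff, h0, h1] at this

/-- Integral matrices of the same determinant that are congruent modulo a multiple of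
`N * det` differ by an element of the principal congruence subgroup of level `N`. -/
theorem exists_congruence_mul_eq {R : Type*} [CommRing R] [IsDomain R]
    {M M' E : Matrix (Fin 2) (Fin 2) R} {N e : R} (hM : M.det ≠ 0) (hdet : M'.det = M.det)
    (hE : M' = M + (M.det * e * N) • E) :
    ∃ (G : SpecialLinearGroup (Fin 2) R) (X : Matrix (Fin 2) (Fin 2) R),
      G.1 = 1 + N • X ∧ G.1 * M = M' := by
  -- The matrix sought is `M' M⁻¹`; the factor `det M` in the congruence cancels the denominator of
  -- `M⁻¹ = adj(M) / det M`.
  set X := e • (E * M.adjugate)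
  have h1 : M' * M.adjugate = M.det • (1 + N • X) := by
    rw [hE, add_mul, mul_adjugate, smul_add, smul_mul_assoc, smul_smul, smul_smul]
    congr 2
    ring
  have h2 : (1 + N • X) * M = M' := by
    have : M.det • ((1 + N • X) * M) = M.det • M' := by
      rw [← smul_mul_assoc, ← h1, Matrix.mul_assoc, adjugate_mul, Matrix.mul_smul, mul_one]
    exact smul_right_injective _ hM this
  refine ⟨⟨1 + N • X, ?_⟩, X, rfl, h2⟩
  have h3 := congrArg det h2
  rw [det_mul, hdet] at h3
  exact mul_right_cancel₀ hM (h3.trans (one_mul _).symm)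

open scoped nonZeroDivisors in
theorem map_mem_twistedGamma {n I : Ideal (𝓞 K)} {N : 𝓞 K} (hn : N ∈ n) (hN : N ∈ I)
    (hN0 : N ≠ 0) {G : SpecialLinearGroup (Fin 2) (𝓞 K)} {X : Matrix (Fin 2) (Fin 2) (𝓞 K)}
    (hG : G.1 = 1 + N • X) :
    SpecialLinearGroup.map (algebraMap (𝓞 K) K) G ∈ twistedGamma K n I := by
  have hI : I ≠ ⊥ := by rintro rfl; exact hN0 (by simpa using hN)
  have hI' : (I : FractionalIdeal (𝓞 K)⁰ K) ≠ 0 := by simpa using hI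
  have hmem : ∀ {J : Ideal (𝓞 K)} (_ : N ∈ J) (x : 𝓞 K),
      algebraMap (𝓞 K) K (N * x) ∈ (J : FractionalIdeal (𝓞 K)⁰ K) := fun hJ x =>
    FractionalIdeal.mem_coeIdeal_of_mem _ (Ideal.mul_mem_right _ _ hJ)
  have e : ∀ i j, SpecialLinearGroup.map (algebraMap (𝓞 K) K) G i j =
    algebraMap (𝓞 K) K (G.1 i j) := fun i j => rfl
  refine ⟨?_, ?_, ?_, ?_⟩
  · rw [e, hG]; simpa using hmem hn (X 0 0)
  · rw [e, hG]; simpa using hmem hn (X 1 1)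
  · rw [e, hG]; simpa using hmem hN (X 0 1)
  · have h1 : (1 : K) ∈ (I : FractionalIdeal (𝓞 K)⁰ K)⁻¹ := by
      rw [FractionalIdeal.mem_inv_iff hI']
      intro y hy
      obtain ⟨z, -, rfl⟩ := (FractionalIdeal.mem_coeIdeal _).1 hy
      rw [one_mul]
      exact (FractionalIdeal.mem_one_iff _).2 ⟨z, rfl⟩
    have := FractionalIdeal.mul_mem_mul (hmem hn (X 1 0)) h1
    rw [mul_one] at this
    rw [e, hG]
    simpa using this

/-- An integer of `K` divides its norm, and a nonzero rational integer of size at most `B` divides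
`B!`. Thus the single modulus `B! N` serves every determinant of norm at most `B`. -/
theorem norm_dvd_factorial {x : 𝓞 K} (hx : x ≠ 0) {B : ℕ}
    (hB : (Algebra.norm ℤ x).natAbs ≤ B) : x ∣ (B.factorial : 𝓞 K) := by
  have h1 : x ∣ ((Algebra.norm ℤ x : ℤ) : 𝓞 K) := by
    have := Algebra.dvd_algebraMap_intNorm_self (A := ℤ) (B := 𝓞 K) x
    rwa [Algebra.intNorm_eq_norm] at this
  have h2 : (Algebra.norm ℤ x) ∣ (B.factorial : ℤ) :=
    Int.natAbs_dvd.1 (Int.natCast_dvd_natCast.2 (Nat.dvd_factorial (Nat.pos_of_ne_zero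
      (Int.natAbs_ne_zero.2 (Algebra.norm_ne_zero_iff.2 hx))) hB))
  refine h1.trans ?_
  have h3 := map_dvd (Int.castRingHom (𝓞 K)) h2
  simpa only [eq_intCast, Int.cast_natCast] using h3

/-- Integral matrices of the same determinant of bounded norm that are congruent modulo a suitable
`m` have `Γ`-equivalent divisors. -/
theorem exists_act_colDiff_eq {n I : Ideal (𝓞 K)} {N : 𝓞 K} (hNn : N ∈ n) (hNI : N ∈ I)
    (hN0 : N ≠ 0) {B : ℕ} {M M' : Matrix (Fin 2) (Fin 2) (𝓞 K)} (hM : M.det ≠ 0)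
    (hB : (Algebra.norm ℤ M.det).natAbs ≤ B) (hdet : M'.det = M.det)
    (hcong : ∀ i j, (B.factorial : 𝓞 K) * N ∣ M' i j - M i j) :
    ∃ γ ∈ twistedGamma K n I, Div0.act (γ : GL (Fin 2) K) (colDiff M) = colDiff M' := by
  obtain ⟨e, he⟩ := norm_dvd_factorial hM hB
  choose E hE using hcong
  obtain ⟨G, X, hG, hGM⟩ := exists_congruence_mul_eq (M := M) (M' := M') (E := of E) (N := N)
    (e := e) hM hdet (by
      ext1 i j
      rw [← he, Matrix.add_apply, Matrix.smul_apply, of_apply, smul_eq_mul, ← hE,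
        add_sub_cancel])
  exact ⟨_, map_mem_twistedGamma hNn hNI hN0 hG, by rw [act_colDiff G hM, hGM]⟩

/-- A `Γ`-invariant function is bounded on the divisors of matrices of bounded determinant. -/
theorem exists_forall_colDiff_le [IsTotallyComplex K] (hK : Module.finrank ℚ K = 2)
    {n I : Ideal (𝓞 K)} (hn : n ≠ ⊥) (hI : I ≠ ⊥) (f : Div0 K → ℝ)
    (hinv : ∀ γ ∈ twistedGamma K n I, ∀ D, f (Div0.act (γ : GL (Fin 2) K) D) ≤ f D) (B : ℕ) :
    ∃ C, ∀ M : Matrix (Fin 2) (Fin 2) (𝓞 K), M.det ≠ 0 →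
      (Algebra.norm ℤ M.det).natAbs ≤ B → f (colDiff M) ≤ C := by
  obtain ⟨N, hN, hN0⟩ := Submodule.exists_mem_ne_zero_of_ne_bot (mul_ne_zero hn hI : n * I ≠ ⊥)
  have hm : (B.factorial : 𝓞 K) * N ≠ 0 :=
    mul_ne_zero (by exact_mod_cast B.factorial_ne_zero) hN0
  generalize hmdef : (B.factorial : 𝓞 K) * N = m at hm
  have : Finite (𝓞 K ⧸ Ideal.span {m}) :=
    Ideal.finiteQuotientOfFreeOfNeBot _ (by simpa using hm)
  have : Finite {x : 𝓞 K // (Algebra.norm ℤ x).natAbs ≤ B} :=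
    (finite_setOf_natAbs_norm_le hK B).to_subtype
  let S := {M : Matrix (Fin 2) (Fin 2) (𝓞 K) // M.det ≠ 0 ∧ (Algebra.norm ℤ M.det).natAbs ≤ B}
  -- Determinant and residues modulo `m` take finitely many values and determine `f (colDiff M)`, so
  -- `f` has finite range on these divisors.
  let c : S → {x : 𝓞 K // (Algebra.norm ℤ x).natAbs ≤ B} ×
      (Fin 2 → Fin 2 → 𝓞 K ⧸ Ideal.span {m}) :=
    fun M => (⟨M.1.det, M.2.2⟩, fun i j => Ideal.Quotient.mk _ (M.1 i j))
  have hle : ∀ M M' : S, c M = c M' → f (colDiff M'.1) ≤ f (colDiff M.1) := by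
    intro M M' h
    obtain ⟨h1, h2⟩ := Prod.ext_iff.1 h
    obtain ⟨γ, hγ, hγM⟩ := exists_act_colDiff_eq (Ideal.mul_le_left hN) (Ideal.mul_le_right hN)
      hN0 M.2.1 M.2.2 (congrArg Subtype.val h1).symm (fun i j => by
        have := congrFun (congrFun h2 i) j
        rw [hmdef]
        exact Ideal.mem_span_singleton.1 (Ideal.Quotient.eq.1 this.symm))
    exact hγM ▸ hinv γ hγ (colDiff M.1)
  -- The equivalence is symmetric in the two matrices, so the one-sided hypothesis `hinv` yields
  -- equality.
  have hfac : Function.FactorsThrough (fun M : S => f (colDiff M.1)) c := fun M M' h =>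
    le_antisymm (hle _ _ h.symm) (hle _ _ h)
  obtain ⟨C, hC⟩ := (Set.finite_range
    (Function.extend c (fun M : S => f (colDiff M.1)) 0)).bddAbove
  exact ⟨C, fun M h1 h2 => hC ⟨c ⟨M, h1, h2⟩, hfac.extend_apply _ _⟩⟩

/-- A `Γ`-invariant function on `Div⁰(ℙ¹(K))` satisfying the ultrametric inequality is bounded. -/
theorem exists_forall_le_of_invariant [IsTotallyComplex K] (hK : Module.finrank ℚ K = 2)
    {n I : Ideal (𝓞 K)} (hn : n ≠ ⊥) (hI : I ≠ ⊥) (f : Div0 K → ℝ)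
    (hzero : f 0 = 0) (hneg : ∀ D, f (-D) = f D) (hadd : ∀ D D', f (D + D') ≤ max (f D) (f D'))
    (hinv : ∀ γ ∈ twistedGamma K n I, ∀ D, f (Div0.act (γ : GL (Fin 2) K) D) ≤ f D) :
    ∃ C, ∀ D, f D ≤ C := by
  obtain ⟨B, hB⟩ := exists_colDiff_generators (K := K) hK
  obtain ⟨C, hC⟩ := exists_forall_colDiff_le hK hn hI f hinv B
  -- The ultrametric inequality makes a sublevel set a subgroup; the maximum with 0 lets it contain
  -- the zero divisor.
  let A : AddSubgroup (Div0 K) :=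
    { carrier := {D | f D ≤ max C 0}
      zero_mem' := hzero.le.trans (le_max_right _ _)
      add_mem' := fun hD hD' => (hadd _ _).trans (max_le hD hD')
      neg_mem' := fun {D} hD => (hneg D).le.trans hD }
  have hA : A = ⊤ := hB A fun M h1 h2 => (hC M h1 h2).trans (le_max_left _ _)
  refine ⟨max C 0, fun D => ?_⟩
  have hD : D ∈ A := hA ▸ AddSubgroup.mem_top D
  exact hD

end Generators

/-! ### Norm estimates for distributions and the contraction by Hecke matrices. -/

section Estimates

open Filter Topology Asymptotics
open scoped NumberField TensorProduct BoundedContinuousFunction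

variable (p : ℕ) [Fact p.Prime] {K : Type*} [Field K]
  {L : Type*} [NontriviallyNormedField L] [NormedAlgebra ℚ_[p] L] [NormedAlgebra L ℂ_[p]]

theorem RigidFun.norm_le {σ₁ σ₂ : K →+* L} {r s : ℝ} (F : RigidFun p σ₁ σ₂ r s) {C : ℝ}
    (hC : 0 ≤ C) (h : ∀ z, ‖F.1 z‖ ≤ C) : ‖F‖ ≤ C :=
  (BoundedContinuousFunction.norm_le hC).2 h

theorem norm_apply_le_distNorm {σ₁ σ₂ : K →+* L} (μ : LocDist p σ₁ σ₂) (r s : Radius)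
    (F : RigidFun p σ₁ σ₂ r s) : ‖μ.1 (r, s) F‖ ≤ distNorm p μ r s * ‖F‖ :=
  (μ.1 (r, s)).le_opNorm F

theorem distNorm_nonneg {σ₁ σ₂ : K →+* L} (μ : LocDist p σ₁ σ₂) (r s : Radius) :
    0 ≤ distNorm p μ r s :=
  ContinuousLinearMap.opNorm_nonneg (μ.1 (r, s))

/-- Restricting a function to a smaller neighbourhood cannot increase its sup norm, and `μ` has the
same value on the restriction. -/
theorem distNorm_antitone {σ₁ σ₂ : K →+* L} (μ : LocDist p σ₁ σ₂) {r s r' s' : Radius}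
    (hr : r ≤ r') (hs : s ≤ s') : distNorm p μ r' s' ≤ distNorm p μ r s := by
  refine ContinuousLinearMap.opNorm_le_bound _ (distNorm_nonneg p _ _ _) fun F => ?_
  have h : (r, s) ≤ (r', s') := ⟨hr, hs⟩
  rw [← μ.2 _ _ h F]
  refine (norm_apply_le_distNorm p μ r s _).trans ?_
  refine mul_le_mul_of_nonneg_left ?_ (distNorm_nonneg p _ _ _)
  exact RigidFun.norm_le p _ (norm_nonneg _) fun z => F.1.norm_coe_le_norm _

theorem distNorm_zero {σ₁ σ₂ : K →+* L} (r s : Radius) :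
    distNorm p (0 : LocDist p σ₁ σ₂) r s = 0 :=
  ContinuousLinearMap.opNorm_zero

theorem distNorm_le_of_add_eq_zero {σ₁ σ₂ : K →+* L} {μ ν : LocDist p σ₁ σ₂} (h : μ + ν = 0)
    (r s : Radius) : distNorm p μ r s ≤ distNorm p ν r s := by
  refine ContinuousLinearMap.opNorm_le_bound _ (distNorm_nonneg p _ _ _) fun F => ?_
  have hF : μ.1 (r, s) F + ν.1 (r, s) F = 0 :=
    congrArg (fun κ : LocDist p σ₁ σ₂ => κ.1 (r, s) F) h
  rw [eq_neg_of_add_eq_zero_left hF, norm_neg]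
  exact norm_apply_le_distNorm p ν r s F

theorem distNorm_le_of_smul {σ₁ σ₂ : K →+* L} {c : L} (hc : c ≠ 0) (μ : LocDist p σ₁ σ₂)
    (r s : Radius) : distNorm p μ r s ≤ ‖c‖⁻¹ * distNorm p (c • μ) r s := by
  refine ContinuousLinearMap.opNorm_le_bound _
    (mul_nonneg (inv_nonneg.2 (norm_nonneg c)) (distNorm_nonneg p _ _ _)) fun F => ?_
  rw [mul_assoc, le_inv_mul_iff₀ (norm_pos_iff.2 hc), ← norm_mul]
  exact norm_apply_le_distNorm p (c • μ) r s F

theorem distNorm_add_le_max {σ₁ σ₂ : K →+* L} (μ ν : LocDist p σ₁ σ₂) (r s : Radius) :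
    distNorm p (μ + ν) r s ≤ max (distNorm p μ r s) (distNorm p ν r s) := by
  have : IsUltrametricDist L := IsUltrametricDist.of_normedAlgebra ℚ_[p]
  refine ContinuousLinearMap.opNorm_le_bound _ (le_max_of_le_left (distNorm_nonneg p _ _ _)) fun F => ?_
  refine (IsUltrametricDist.norm_add_le_max (μ.1 (r, s) F) (ν.1 (r, s) F)).trans ?_
  rw [max_mul_of_nonneg _ _ (norm_nonneg _)]
  exact max_le_max (norm_apply_le_distNorm p μ r s F) (norm_apply_le_distNorm p ν r s F)

/-- By the ultrametric inequality the number of terms does not enter; otherwise each application of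
a Hecke operator would cost a factor `|S|` and spoil the exponent. -/
theorem distNorm_sum_le {σ₁ σ₂ : K →+* L} {ι : Type*} (S : Finset ι)
    (μ : ι → LocDist p σ₁ σ₂) (r s : Radius) {C : ℝ} (hC : 0 ≤ C)
    (h : ∀ i ∈ S, distNorm p (μ i) r s ≤ C) : distNorm p (∑ i ∈ S, μ i) r s ≤ C := by
  classical
  induction S using Finset.induction_on with
  | empty => rw [Finset.sum_empty, distNorm_zero]; exact hC
  | insert i S hi ih =>
    rw [Finset.sum_insert hi]
    exact (distNorm_add_le_max p _ _ r s).trans (max_le (h i (Finset.mem_insert_self i S))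
      (ih fun j hj => h j (Finset.mem_insert_of_mem hj)))

/-- The automorphy factors have absolute value 1 and the transformation preserves the neighbourhood,
so the action on functions is norm-decreasing. -/
theorem distNorm_slash_le (σ₁ σ₂ : K →+* L) (k : ℕ) {g : GL (Fin 2) K}
    (hg : IsSigmaZero p σ₁ σ₂ g) (μ : LocDist p σ₁ σ₂) (r s : Radius) :
    distNorm p (slash p σ₁ σ₂ k hg μ) r s ≤ distNorm p μ r s := by
  refine ContinuousLinearMap.opNorm_le_bound _ (distNorm_nonneg p _ _ _) fun F => ?_
  refine (norm_apply_le_distNorm p μ r s (weightAct p σ₁ σ₂ k hg r s F)).trans ?_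
  refine mul_le_mul_of_nonneg_left ?_ (distNorm_nonneg p _ _ _)
  exact RigidFun.norm_le p _ (norm_nonneg _) fun z =>
    (norm_weightFun p σ₁ σ₂ k hg r s F.1 z).le.trans (F.1.norm_coe_le_norm _)

section Dilation

variable {p}

theorem dilation_sub_center (σ : K →+* L) (a β : 𝓞 K) (u : LocalIntegers p K) (x : ℂ_[p]) :
    algebraMap L ℂ_[p] (σ a) + algebraMap L ℂ_[p] (σ β) * x -
        algebraMap L ℂ_[p] (localEmb p σ (1 ⊗ₜ a + 1 ⊗ₜ β * u)) =
      algebraMap L ℂ_[p] (σ β) * (x - algebraMap L ℂ_[p] (localEmb p σ u)) := by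
  rw [map_add, map_mul, localEmb_one_tmul, localEmb_one_tmul, map_add, map_mul]
  ring

theorem norm_dilation_sub_center_le (σ : K →+* L) (a β : 𝓞 K) (u : LocalIntegers p K)
    {x : ℂ_[p]} {r r' : ℝ} (hr : ‖σ β‖ * r' ≤ r)
    (hx : ‖x - algebraMap L ℂ_[p] (localEmb p σ u)‖ ≤ r') :
    ‖algebraMap L ℂ_[p] (σ a) + algebraMap L ℂ_[p] (σ β) * x -
      algebraMap L ℂ_[p] (localEmb p σ (1 ⊗ₜ a + 1 ⊗ₜ β * u))‖ ≤ r := by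
  rw [dilation_sub_center, norm_mul, norm_algebraMap']
  exact (mul_le_mul_of_nonneg_left hx (norm_nonneg _)).trans hr

theorem dilation_mem (σ₁ σ₂ : K →+* L) (a β : 𝓞 K) {r s r' s' : ℝ} (hr : ‖σ₁ β‖ * r' ≤ r)
    (hs : ‖σ₂ β‖ * s' ≤ s) {z : ℂ_[p] × ℂ_[p]} (hz : z ∈ Nbhd p σ₁ σ₂ r' s') :
    (algebraMap L ℂ_[p] (σ₁ a) + algebraMap L ℂ_[p] (σ₁ β) * z.1,
      algebraMap L ℂ_[p] (σ₂ a) + algebraMap L ℂ_[p] (σ₂ β) * z.2) ∈ Nbhd p σ₁ σ₂ r s := by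
  obtain ⟨u, h₁, h₂⟩ := hz
  exact ⟨1 ⊗ₜ a + 1 ⊗ₜ β * u, norm_dilation_sub_center_le σ₁ a β u hr h₁,
    norm_dilation_sub_center_le σ₂ a β u hs h₂⟩

/-- Pullback along `(x, y) ↦ (σ₁(a) + σ₁(β) x, σ₂(a) + σ₂(β) y)`, which maps a larger
neighbourhood into a smaller one. -/
noncomputable def dilate (σ₁ σ₂ : K →+* L) (a β : 𝓞 K) (r s r' s' : Radius)
    (hr : ‖σ₁ β‖ * r' ≤ r) (hs : ‖σ₂ β‖ * s' ≤ s) (F : RigidFun p σ₁ σ₂ r s) :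
    RigidFun p σ₁ σ₂ r' s' :=
  ⟨F.1.compContinuous ⟨fun z => ⟨_, dilation_mem σ₁ σ₂ a β hr hs z.2⟩, by fun_prop⟩, by
    intro u
    obtain ⟨c, hc, hcF⟩ := F.2 (1 ⊗ₜ a + 1 ⊗ₜ β * u)
    -- The substitution carries the centre `u` to `a + βu` and scales the two local coordinates by
    -- `σ₁(β)` and `σ₂(β)`.
    refine ⟨fun i => c i * σ₁ β ^ i.1 * σ₂ β ^ i.2, ?_, fun z h₁ h₂ => ?_⟩
    · have hr0 : (0 : ℝ) ≤ r' := r'.2.1.le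
      have hs0 : (0 : ℝ) ≤ s' := s'.2.1.le
      refine squeeze_zero (fun i => by positivity) (fun i => ?_) hc
      rw [norm_mul, norm_mul, norm_pow, norm_pow]
      calc ‖c i‖ * ‖σ₁ β‖ ^ i.1 * ‖σ₂ β‖ ^ i.2 * (r' : ℝ) ^ i.1 * (s' : ℝ) ^ i.2
          = ‖c i‖ * (‖σ₁ β‖ * r') ^ i.1 * (‖σ₂ β‖ * s') ^ i.2 := by rw [mul_pow, mul_pow]; ring
        _ ≤ ‖c i‖ * (r : ℝ) ^ i.1 * (s : ℝ) ^ i.2 := by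
          have hr1 : (0 : ℝ) ≤ r := r.2.1.le
          gcongr
    · have h := hcF ⟨_, dilation_mem σ₁ σ₂ a β hr hs z.2⟩
        (norm_dilation_sub_center_le σ₁ a β u hr h₁) (norm_dilation_sub_center_le σ₂ a β u hs h₂)
      refine (congrArg (HasSum · _) (funext fun i => ?_)).mp h
      rw [dilation_sub_center, dilation_sub_center]
      simp only [map_mul, map_pow, mul_pow]
      ring⟩

theorem norm_dilate_le (σ₁ σ₂ : K →+* L) (a β : 𝓞 K) (r s r' s' : Radius)
    (hr : ‖σ₁ β‖ * r' ≤ r) (hs : ‖σ₂ β‖ * s' ≤ s) (F : RigidFun p σ₁ σ₂ r s) :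
    ‖dilate σ₁ σ₂ a β r s r' s' hr hs F‖ ≤ ‖F‖ :=
  RigidFun.norm_le p _ (norm_nonneg _) fun _ => F.1.norm_coe_le_norm _

/-- The key factorisation: acting by `(1, a; 0, β)` first extends `F` to a larger neighbourhood and
then restricts. The weight `k` disappears because the automorphy factors are 1. -/
theorem res_dilate (σ₁ σ₂ : K →+* L) (k : ℕ) (a β : 𝓞 K) (hβ : β ≠ 0) (r s r' s' : Radius)
    (hr : ‖σ₁ β‖ * r' ≤ r) (hs : ‖σ₂ β‖ * s' ≤ s) (h : (r, s) ≤ (r', s'))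
    (F : RigidFun p σ₁ σ₂ r s) :
    RigidFun.res p σ₁ σ₂ h (dilate σ₁ σ₂ a β r s r' s' hr hs F) =
      weightAct p σ₁ σ₂ k (isSigmaZero_heckeMat p σ₁ σ₂ a β hβ) r s F := by
  apply Subtype.ext
  apply BoundedContinuousFunction.ext
  intro z
  have hA : ∀ (σ : K →+* L) (x : ℂ_[p]), autFactor p σ (heckeMat a β hβ) x = 1 := by
    intro σ x
    simp [autFactor, coe_heckeMat]
  have hM : ∀ (σ : K →+* L) (x : ℂ_[p]), moebius p σ (heckeMat a β hβ) x =
      algebraMap L ℂ_[p] (σ a) + algebraMap L ℂ_[p] (σ β) * x := by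
    intro σ x
    rw [moebius, hA, div_one]
    simp [coe_heckeMat]
  change F.1 _ = weightFun p σ₁ σ₂ k (isSigmaZero_heckeMat p σ₁ σ₂ a β hβ) r s F.1 z
  rw [weightFun, hA, hA, one_pow, one_mul, one_mul]
  congr 1
  apply Subtype.ext
  change (_, _) = (_, _)
  rw [hM, hM]
  rfl

/-- Acting by `(1, a; 0, β)` improves radii by the factors `|σ₁(β)|`, `|σ₂(β)|`. -/
theorem distNorm_slash_heckeMat_le (σ₁ σ₂ : K →+* L) (k : ℕ) (a β : 𝓞 K) (hβ : β ≠ 0)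
    {r s r' s' : Radius} (hr : ‖σ₁ β‖ * r' ≤ r) (hs : ‖σ₂ β‖ * s' ≤ s) (hrr : r ≤ r')
    (hss : s ≤ s') (μ : LocDist p σ₁ σ₂) :
    distNorm p (slash p σ₁ σ₂ k (isSigmaZero_heckeMat p σ₁ σ₂ a β hβ) μ) r s ≤
      distNorm p μ r' s' := by
  refine ContinuousLinearMap.opNorm_le_bound _ (distNorm_nonneg p _ _ _) fun F => ?_
  change ‖μ.1 (r, s) (weightAct p σ₁ σ₂ k _ r s F)‖ ≤ _
  have h : (r, s) ≤ (r', s') := ⟨hrr, hss⟩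
  -- Compatibility of the family `μ` moves the evaluation from `(r, s)` to `(r', s')`.
  rw [← res_dilate σ₁ σ₂ k a β hβ r s r' s' hr hs h F, μ.2 _ _ h]
  refine (norm_apply_le_distNorm p μ r' s' _).trans ?_
  exact mul_le_mul_of_nonneg_left (norm_dilate_le σ₁ σ₂ a β r s r' s' hr hs F)
    (distNorm_nonneg p _ _ _)

/-- The eigenvalue equation expresses `c Ψ(D)` through values at translated divisors, hence a
hypothesis uniform in `D`; the conclusion is again uniform, so it can be iterated. -/
theorem IsEigensymbol.distNorm_le {σ₁ σ₂ : K →+* L} {k : ℕ} {S : Finset (𝓞 K)} {β : 𝓞 K}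
    {hβ : β ≠ 0} {Ψ : Div0 K →+ LocDist p σ₁ σ₂} {c : L}
    (hΨ : IsEigensymbol p σ₁ σ₂ k S β hβ Ψ c) (hc : c ≠ 0)
    {r s r' s' : Radius} (hr : ‖σ₁ β‖ * r' ≤ r) (hs : ‖σ₂ β‖ * s' ≤ s) (hrr : r ≤ r')
    (hss : s ≤ s') {C : ℝ} (hC : ∀ D, distNorm p (Ψ D) r' s' ≤ C) (D : Div0 K) :
    distNorm p (Ψ D) r s ≤ ‖c‖⁻¹ * C := by
  refine (distNorm_le_of_smul p hc _ r s).trans ?_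
  rw [← hΨ D, hecke]
  refine mul_le_mul_of_nonneg_left ?_ (inv_nonneg.2 (norm_nonneg c))
  exact distNorm_sum_le p S _ r s ((distNorm_nonneg p _ _ _).trans (hC 0)) fun a _ =>
    (distNorm_slash_heckeMat_le σ₁ σ₂ k a β hβ hr hs hrr hss _).trans (hC _)

end Dilation

end Estimates

/-! ### Iteration of the eigenvalue equation and admissibility. -/

section Admissibility

open Filter Topology Asymptotics
open scoped NumberField MatrixGroups

variable {p : ℕ} [Fact p.Prime] {K : Type*} [Field K]
  {L : Type*} [NontriviallyNormedField L]

theorem inv_prime_lt_one : (p : ℝ)⁻¹ < 1 :=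
  inv_lt_one_of_one_lt₀ (by exact_mod_cast (Fact.out : p.Prime).one_lt)

theorem inv_prime_pos : 0 < (p : ℝ)⁻¹ :=
  inv_pos.2 (by exact_mod_cast (Fact.out : p.Prime).pos)

theorem norm_eq_inv_prime_rpow_padicVal {c : L} (hc : c ≠ 0) :
    ‖c‖ = (p : ℝ)⁻¹ ^ padicVal p c := by
  have hp1 : (1 : ℝ) < p := by exact_mod_cast (Fact.out : p.Prime).one_lt
  rw [padicVal, Real.inv_rpow (by positivity), ← Real.rpow_neg (by positivity), neg_neg,
    Real.rpow_logb (by positivity) hp1.ne' (norm_pos_iff.2 hc)]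

/-- With contraction ratio `q = p⁻ᵐ`, the eigenvalue `cᵐ` has norm `q ^ v(c)`, so the order is
`v(c)` rather than `m v(c)`. -/
theorem norm_pow_eq_inv_prime_pow_rpow_padicVal {c : L} (hc : c ≠ 0) (m : ℕ) :
    ‖c ^ m‖ = ((p : ℝ)⁻¹ ^ m) ^ padicVal p c := by
  rw [norm_pow, norm_eq_inv_prime_rpow_padicVal (p := p) hc, ← Real.rpow_natCast,
    ← Real.rpow_natCast, ← Real.rpow_mul inv_prime_pos.le, ← Real.rpow_mul inv_prime_pos.le,
    mul_comm]

variable [NormedAlgebra ℚ_[p] L]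

theorem norm_embedding_natCast_self (σ : K →+* L) : ‖σ (p : K)‖ = (p : ℝ)⁻¹ := by
  rw [map_natCast, ← map_natCast (algebraMap ℚ_[p] L), norm_algebraMap', Padic.norm_p]

variable (p) in
theorem norm_embedding_le_of_mem_span_pow (σ : K →+* L) {m : ℕ} {x : 𝓞 K}
    (hx : x ∈ Ideal.span {(p : 𝓞 K)} ^ m) : ‖σ x‖ ≤ (p : ℝ)⁻¹ ^ m := by
  rw [Ideal.span_singleton_pow, Ideal.mem_span_singleton] at hx
  obtain ⟨y, rfl⟩ := hx
  push_cast
  rw [map_mul, map_pow, norm_mul, norm_pow, norm_embedding_natCast_self]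
  exact mul_le_of_le_one_right (pow_nonneg inv_prime_pos.le _) (norm_embedding_le_one p σ y)

/-- If `I = 0`, coprimality forces `𝔫 = (1)`, so `p` divides 1, contradicting `|σ(1)| = 1 > p⁻¹`. -/
theorem ne_bot_of_isCoprime (σ : K →+* L) {n I : Ideal (𝓞 K)}
    (hpn : Ideal.span {(p : 𝓞 K)} ∣ n) (hI : IsCoprime I n) : I ≠ ⊥ := by
  rintro rfl
  have hn : n = ⊤ := by simpa using Ideal.isCoprime_iff_sup_eq.1 hI
  have h1 : (1 : 𝓞 K) ∈ Ideal.span {(p : 𝓞 K)} ^ 1 := by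
    rw [pow_one]
    exact Ideal.le_of_dvd hpn (hn ▸ Submodule.mem_top)
  have h2 := norm_embedding_le_of_mem_span_pow p σ h1
  rw [show ((1 : 𝓞 K) : K) = 1 from map_one _, map_one, norm_one, pow_one] at h2
  exact absurd inv_prime_lt_one (not_lt.2 h2)

/-- If `(p) = P Q` with `P`, `Q` coprime and `|σ| < 1` on `P`, then `|σ| ≤ p⁻ᵐ` on `Pᵐ`. -/
theorem norm_embedding_le_of_mem_pow (σ : K →+* L) {P Q : Ideal (𝓞 K)} (hPQ : IsCoprime P Q)
    (hmul : P * Q = Ideal.span {(p : 𝓞 K)}) (hσ : ∀ x ∈ P, ‖σ x‖ < 1) {m : ℕ} {x : 𝓞 K}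
    (hx : x ∈ P ^ m) : ‖σ x‖ ≤ (p : ℝ)⁻¹ ^ m := by
  have : IsUltrametricDist L := IsUltrametricDist.of_normedAlgebra ℚ_[p]
  -- From `y + z = 1` and `|σ(y)| < 1` one gets `|σ(z)| = 1`, so multiplying `x` by `zᵐ` lands in
  -- `(p)ᵐ` without changing `|σ(x)|`.
  obtain ⟨y, hy, z, hz, hyz⟩ := Ideal.isCoprime_iff_exists.1 hPQ
  have hσz : ‖σ z‖ = 1 := by
    have h1 : σ (z : K) = 1 - σ (y : K) := by
      rw [← map_one σ, ← map_sub, ← map_one (algebraMap (𝓞 K) K), ← hyz, map_add,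
        add_sub_cancel_left]
    rw [h1, sub_eq_add_neg, IsUltrametricDist.norm_add_eq_max_of_norm_ne_norm] <;>
    simp [(hσ y hy).ne', (hσ y hy).le]
  have hmem : x * z ^ m ∈ Ideal.span {(p : 𝓞 K)} ^ m := by
    rw [← hmul, mul_pow]
    exact Ideal.mul_mem_mul hx (Ideal.pow_mem_pow hz m)
  have h2 := norm_embedding_le_of_mem_span_pow p σ hmem
  push_cast at h2
  rwa [map_mul, map_pow, norm_mul, norm_pow, hσz, one_pow, mul_one] at h2

theorem isCoprime_of_mul_eq_span [NumberField K] {P Q : Ideal (𝓞 K)} (hP : P.IsPrime)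
    (hQ : Q.IsPrime) (hne : P ≠ Q) {x : 𝓞 K} (hx : x ≠ 0) (h : P * Q = Ideal.span {x}) :
    IsCoprime P Q := by
  have h0 : P * Q ≠ 0 := by
    rw [h]
    simpa using hx
  have hPm := hP.isMaximal (left_ne_zero_of_mul h0)
  have hQm := hQ.isMaximal (right_ne_zero_of_mul h0)
  exact Ideal.isCoprime_of_isMaximal hne

/-- The radius `q ^ N`. -/
def powRadius (q : ℝ) (hq : 0 < q) (hq1 : q < 1) (N : ℕ) : Radius :=
  ⟨q ^ N, pow_pos hq N, pow_le_one₀ hq.le hq1.le⟩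

theorem powRadius_succ_le {q : ℝ} (hq : 0 < q) (hq1 : q < 1) (N : ℕ) :
    powRadius q hq hq1 (N + 1) ≤ powRadius q hq hq1 N :=
  Subtype.coe_le_coe.1 (pow_le_pow_of_le_one hq.le hq1.le N.le_succ)

/-- Choose `N` with `q ^ (N + 1) < r ≤ q ^ N` and use the power `N + 1`. For `h ≤ 0` this loses
nothing; for `h ≥ 0` the extra step costs `q ^ (-h)`, whence the constant. -/
theorem exists_powRadius_le {q : ℝ} (hq : 0 < q) (hq1 : q < 1) (h : ℝ) :
    ∃ C : ℝ, 0 ≤ C ∧ ∀ r : Radius, ∃ N : ℕ, powRadius q hq hq1 N ≤ r ∧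
      (q ^ h)⁻¹ ^ N ≤ C * (r : ℝ) ^ (-h) := by
  refine ⟨max 1 (q ^ (-h)), by positivity, fun r => ?_⟩
  obtain ⟨N, hN1, hN2⟩ := exists_nat_pow_near_of_lt_one r.2.1 r.2.2 hq hq1
  have hr : (0 : ℝ) < r := r.2.1
  have hpow : ∀ j : ℕ, (q ^ h)⁻¹ ^ j = (q ^ j) ^ (-h) := fun j => by
    rw [← Real.rpow_neg hq.le, ← Real.rpow_natCast, ← Real.rpow_natCast, ← Real.rpow_mul hq.le,
      ← Real.rpow_mul hq.le, mul_comm]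
  refine ⟨N + 1, Subtype.coe_le_coe.1 hN1.le, ?_⟩
  rcases le_total h 0 with h0 | h0
  · rw [hpow]
    calc (q ^ (N + 1)) ^ (-h) ≤ (r : ℝ) ^ (-h) :=
          Real.rpow_le_rpow (by positivity) hN1.le (by linarith)
      _ ≤ _ := le_mul_of_one_le_left (by positivity) (le_max_left _ _)
  · rw [pow_succ', hpow, ← Real.rpow_neg hq.le]
    exact mul_le_mul (le_max_right _ _) (Real.rpow_le_rpow_of_nonpos hr hN2 (by linarith))
      (by positivity) (by positivity)

theorem mul_powRadius_le {q : ℝ} (hq : 0 < q) (hq1 : q < 1) {x : ℝ} (hx : x ≤ q) (N : ℕ) :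
    x * powRadius q hq hq1 N ≤ powRadius q hq hq1 (N + 1) :=
  (mul_le_mul_of_nonneg_right hx (pow_nonneg hq.le N)).trans_eq (pow_succ' q N).symm

variable [NormedAlgebra L ℂ_[p]]

/-- The norms `‖Ψ(D)‖_{r,s}` of the values of a modular symbol are bounded. -/
theorem exists_forall_distNorm_le [NumberField K] [NumberField.IsTotallyComplex K]
    (hK : Module.finrank ℚ K = 2) {σ₁ σ₂ : K →+* L} {k : ℕ} {n I : Ideal (𝓞 K)} (hn : n ≠ ⊥)
    (hpn : Ideal.span {(p : 𝓞 K)} ∣ n) (hI : IsCoprime I n) {Ψ : Div0 K →+ LocDist p σ₁ σ₂}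
    (hΨ : Ψ ∈ Symb p σ₁ σ₂ k hpn hI) (r s : Radius) :
    ∃ C, ∀ D, distNorm p (Ψ D) r s ≤ C := by
  have hneg : ∀ D, distNorm p (Ψ (-D)) r s ≤ distNorm p (Ψ D) r s := fun D =>
    distNorm_le_of_add_eq_zero p (by rw [← map_add, neg_add_cancel, map_zero]) r s
  refine exists_forall_le_of_invariant hK hn (ne_bot_of_isCoprime σ₁ hpn hI)
    (fun D => distNorm p (Ψ D) r s) ?_ (fun D => le_antisymm (hneg D) ?_) (fun D D' => ?_)
    (fun γ hγ D => ?_)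
  · simp only [map_zero]
    exact distNorm_zero p r s
  · simpa only [neg_neg] using hneg (-D)
  · simp only [map_add]
    exact distNorm_add_le_max p _ _ r s
  -- Invariance under `γ⁻¹`, evaluated at `γD`, reads `Ψ(γD) = Ψ(D)|γ⁻¹`.
  · have h := hΨ γ⁻¹ (inv_mem hγ) (Div0.act (γ : GL (Fin 2) K) D)
    have h2 : Div0.act ((γ⁻¹ : Matrix.SpecialLinearGroup (Fin 2) K) : GL (Fin 2) K)
        (Div0.act (γ : GL (Fin 2) K) D) = D := by
      rw [map_inv]
      exact Div0.act_inv_act _ D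
    simp only [h2] at h
    change distNorm p (Ψ (Div0.act (γ : GL (Fin 2) K) D)) r s ≤ _
    rw [h]
    exact distNorm_slash_le p σ₁ σ₂ k _ _ r s

/-- The two radii are independent sequences so that one of them may stay constant while the other
shrinks. -/
theorem IsEigensymbol.distNorm_iterate_le {σ₁ σ₂ : K →+* L} {k : ℕ} {S : Finset (𝓞 K)} {β : 𝓞 K}
    {hβ : β ≠ 0} {Ψ : Div0 K →+ LocDist p σ₁ σ₂} {c : L}
    (hΨ : IsEigensymbol p σ₁ σ₂ k S β hβ Ψ c) (hc : c ≠ 0) {r s : ℕ → Radius}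
    (hr : ∀ N, ‖σ₁ β‖ * r N ≤ r (N + 1)) (hs : ∀ N, ‖σ₂ β‖ * s N ≤ s (N + 1))
    (hrr : ∀ N, r (N + 1) ≤ r N) (hss : ∀ N, s (N + 1) ≤ s N) {C : ℝ}
    (hC : ∀ D, distNorm p (Ψ D) (r 0) (s 0) ≤ C) (N : ℕ) :
    ∀ D, distNorm p (Ψ D) (r N) (s N) ≤ ‖c‖⁻¹ ^ N * C := by
  induction N with
  | zero => simpa using hC
  | succ N ih =>
    intro D
    rw [pow_succ', mul_assoc]
    exact hΨ.distNorm_le hc (hr N) (hs N) (hrr N) (hss N) ih D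

/-- If `β` contracts both coordinates by `q`, an eigenvalue of norm `q ^ h` gives
`h`-admissibility. -/
theorem IsEigensymbol.isAdmissible {σ₁ σ₂ : K →+* L} {k : ℕ} {S : Finset (𝓞 K)} {β : 𝓞 K}
    {hβ : β ≠ 0} {Ψ : Div0 K →+ LocDist p σ₁ σ₂} {c : L}
    (hΨ : IsEigensymbol p σ₁ σ₂ k S β hβ Ψ c) (hc : c ≠ 0)
    (hbdd : ∀ r s : Radius, ∃ C, ∀ D, distNorm p (Ψ D) r s ≤ C) {q h : ℝ} (hq : 0 < q)
    (hq1 : q < 1) (h₁ : ‖σ₁ β‖ ≤ q) (h₂ : ‖σ₂ β‖ ≤ q) (hch : ‖c‖ = q ^ h) (D : Div0 K) :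
    IsAdmissible p (Ψ D) h := by
  obtain ⟨C, hC0, hC⟩ := exists_powRadius_le hq hq1 h
  -- The iteration starts from radii `q ^ 0 = 1`.
  obtain ⟨B, hB⟩ := hbdd (powRadius q hq hq1 0) (powRadius q hq hq1 0)
  have hB0 : 0 ≤ B := (distNorm_nonneg p _ _ _).trans (hB 0)
  refine IsBigO.of_bound (C * B) (Eventually.of_forall fun r => ?_)
  have hr : (0 : ℝ) < r := r.2.1
  obtain ⟨N, hN, hNC⟩ := hC r
  rw [Real.norm_of_nonneg (distNorm_nonneg p _ _ _), Real.norm_of_nonneg (by positivity)]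
  calc distNorm p (Ψ D) r r
      ≤ distNorm p (Ψ D) (powRadius q hq hq1 N) (powRadius q hq hq1 N) :=
        distNorm_antitone p _ hN hN
    _ ≤ ‖c‖⁻¹ ^ N * B := hΨ.distNorm_iterate_le hc (mul_powRadius_le hq hq1 h₁)
        (mul_powRadius_le hq hq1 h₂)
        (powRadius_succ_le hq hq1) (powRadius_succ_le hq hq1) hB N D
    _ ≤ C * (r : ℝ) ^ (-h) * B := mul_le_mul_of_nonneg_right (hch ▸ hNC) hB0
    _ = _ := by ring

/-- The second radius is kept fixed, which is allowed because `|σ₂(β)| ≤ 1`. The constant is chosen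
before `s` and `B`, so `B` may later depend on `s`. -/
theorem IsEigensymbol.exists_distNorm_le_fst {σ₁ σ₂ : K →+* L} {k : ℕ} {S : Finset (𝓞 K)}
    {β : 𝓞 K} {hβ : β ≠ 0} {Ψ : Div0 K →+ LocDist p σ₁ σ₂} {c : L}
    (hΨ : IsEigensymbol p σ₁ σ₂ k S β hβ Ψ c) (hc : c ≠ 0) {q h : ℝ} (hq : 0 < q) (hq1 : q < 1)
    (hβq : ‖σ₁ β‖ ≤ q) (hch : ‖c‖ = q ^ h) :
    ∃ C : ℝ, ∀ (s : Radius) (B : ℝ), (∀ D, distNorm p (Ψ D) (powRadius q hq hq1 0) s ≤ B) →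
      ∀ (r : Radius) (D : Div0 K), distNorm p (Ψ D) r s ≤ C * (r : ℝ) ^ (-h) * B := by
  obtain ⟨C, -, hC⟩ := exists_powRadius_le hq hq1 h
  refine ⟨C, fun s B hB r D => ?_⟩
  obtain ⟨N, hN, hNC⟩ := hC r
  have hB0 : 0 ≤ B := (distNorm_nonneg p _ _ _).trans (hB 0)
  have h1 := hΨ.distNorm_iterate_le hc (r := powRadius q hq hq1) (s := fun _ => s)
    (mul_powRadius_le hq hq1 hβq) (fun _ => mul_le_of_le_one_left s.2.1.le (norm_embedding_le_one p σ₂ β))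
    (powRadius_succ_le hq hq1) (fun _ => le_rfl) hB N D
  rw [hch] at h1
  exact (distNorm_antitone p _ hN le_rfl).trans
    (h1.trans (mul_le_mul_of_nonneg_right hNC hB0))

theorem IsEigensymbol.exists_distNorm_le_snd {σ₁ σ₂ : K →+* L} {k : ℕ} {S : Finset (𝓞 K)}
    {β : 𝓞 K} {hβ : β ≠ 0} {Ψ : Div0 K →+ LocDist p σ₁ σ₂} {c : L}
    (hΨ : IsEigensymbol p σ₁ σ₂ k S β hβ Ψ c) (hc : c ≠ 0) {q h : ℝ} (hq : 0 < q) (hq1 : q < 1)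
    (hβq : ‖σ₂ β‖ ≤ q) (hch : ‖c‖ = q ^ h) :
    ∃ C : ℝ, ∀ (r : Radius) (B : ℝ), (∀ D, distNorm p (Ψ D) r (powRadius q hq hq1 0) ≤ B) →
      ∀ (s : Radius) (D : Div0 K), distNorm p (Ψ D) r s ≤ C * (s : ℝ) ^ (-h) * B := by
  obtain ⟨C, -, hC⟩ := exists_powRadius_le hq hq1 h
  refine ⟨C, fun r B hB s D => ?_⟩
  obtain ⟨N, hN, hNC⟩ := hC s
  have hB0 : 0 ≤ B := (distNorm_nonneg p _ _ _).trans (hB 0)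
  have h1 := hΨ.distNorm_iterate_le hc (r := fun _ => r) (s := powRadius q hq hq1)
    (fun _ => mul_le_of_le_one_left r.2.1.le (norm_embedding_le_one p σ₁ β)) (mul_powRadius_le hq hq1 hβq)
    (fun _ => le_rfl) (powRadius_succ_le hq hq1) hB N D
  rw [hch] at h1
  exact (distNorm_antitone p _ le_rfl hN).trans
    (h1.trans (mul_le_mul_of_nonneg_right hNC hB0))

set_option maxHeartbeats 800000 in
/-- If `β` contracts the first coordinate by `q` and `δ` the second one, eigenvalues of norms
`q ^ h₁` and `q ^ h₂` give `(h₁, h₂)`-admissibility. -/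
theorem IsEigensymbol.isSplitAdmissible {σ₁ σ₂ : K →+* L} {k : ℕ} {S T : Finset (𝓞 K)}
    {β δ : 𝓞 K} {hβ : β ≠ 0} {hδ : δ ≠ 0} {Ψ : Div0 K →+ LocDist p σ₁ σ₂} {c d : L}
    (hΨ : IsEigensymbol p σ₁ σ₂ k S β hβ Ψ c) (hΨ' : IsEigensymbol p σ₁ σ₂ k T δ hδ Ψ d)
    (hc : c ≠ 0) (hd : d ≠ 0) (hbdd : ∀ r s : Radius, ∃ C, ∀ D, distNorm p (Ψ D) r s ≤ C)
    {q h₁ h₂ : ℝ} (hq : 0 < q) (hq1 : q < 1) (hβq : ‖σ₁ β‖ ≤ q) (hδq : ‖σ₂ δ‖ ≤ q)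
    (hch : ‖c‖ = q ^ h₁) (hdh : ‖d‖ = q ^ h₂) (D : Div0 K) :
    IsSplitAdmissible p (Ψ D) h₁ h₂ := by
  obtain ⟨C₁, hC₁⟩ := hΨ.exists_distNorm_le_fst hc hq hq1 hβq hch
  obtain ⟨C₂, hC₂⟩ := hΨ'.exists_distNorm_le_snd hd hq hq1 hδq hdh
  refine ⟨fun s₀ => ?_, fun r₀ => ?_, ?_⟩
  · obtain ⟨B, hB⟩ := hbdd (powRadius q hq hq1 0) s₀
    refine ⟨C₁ * B, fun r s hs => ?_⟩
    have h1 : distNorm p (Ψ D) r s ≤ distNorm p (Ψ D) r s₀ :=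
      distNorm_antitone p (Ψ D) (le_refl r) hs
    exact h1.trans ((hC₁ s₀ B hB r D).trans_eq (mul_right_comm C₁ _ B))
  · obtain ⟨B, hB⟩ := hbdd r₀ (powRadius q hq hq1 0)
    refine ⟨C₂ * B, fun r s hr => ?_⟩
    have h1 : distNorm p (Ψ D) r s ≤ distNorm p (Ψ D) r₀ s :=
      distNorm_antitone p (Ψ D) hr (le_refl s)
    exact h1.trans ((hC₂ r₀ B hB s D).trans_eq (mul_right_comm C₂ _ B))
  · obtain ⟨B, hB⟩ := hbdd (powRadius q hq hq1 0) (powRadius q hq hq1 0)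
    refine ⟨C₁ * C₂ * B, fun r s => ?_⟩
    -- The second iteration bounds the norms at `(1, s)` uniformly in `D` by `C₂ s ^ (-h₂) B`; this
    -- serves as the starting bound of the first.
    refine (hC₁ s _ (hC₂ _ B hB s) r D).trans_eq ?_
    ring

end Admissibility

end BianchiSymb

open BianchiSymb

open scoped NumberField
theorem mainTheorem7 (p : ℕ) [Fact p.Prime] (K : Type*) [Field K] [NumberField K]
    [NumberField.IsTotallyComplex K] (hK : Module.finrank ℚ K = 2)
    (L : Type*) [NontriviallyNormedField L] [NormedAlgebra ℚ_[p] L] [FiniteDimensional ℚ_[p] L]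
    [NormedAlgebra L ℂ_[p]] [IsScalarTower ℚ_[p] L ℂ_[p]]
    (σ₁ σ₂ : K →+* L) (hσ : σ₁ ≠ σ₂) (k : ℕ) (n I : Ideal (𝓞 K)) (hn : n ≠ ⊥)
    (hpn : Ideal.span {(p : 𝓞 K)} ∣ n) (hI : IsCoprime I n)
    (Ψ : Div0 K →+ LocDist p σ₁ σ₂) (hΨ : Ψ ∈ Symb p σ₁ σ₂ k hpn hI) :
    (∀ (hp : (p : 𝓞 K) ≠ 0) (S : Finset (𝓞 K)), IsRepSystem (Ideal.span {(p : 𝓞 K)}) S →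
      ∀ c : L, c ≠ 0 → IsEigensymbol p σ₁ σ₂ k S (p : 𝓞 K) hp Ψ c →
      ∀ D : Div0 K, IsAdmissible p (Ψ D) (padicVal p c)) ∧
    (∀ P Q : Ideal (𝓞 K), P.IsPrime → Q.IsPrime → P ≠ Q → P * Q = Ideal.span {(p : 𝓞 K)} →
      (∀ x ∈ P, ‖σ₁ x‖ < 1) → (∀ x ∈ Q, ‖σ₂ x‖ < 1) →
      ∀ (m : ℕ), 0 < m → ∀ (β δ : 𝓞 K) (hβ : β ≠ 0) (hδ : δ ≠ 0),
      P ^ m = Ideal.span {β} → Q ^ m = Ideal.span {δ} →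
      ∀ S T : Finset (𝓞 K), IsRepSystem (P ^ m) S → IsRepSystem (Q ^ m) T →
      ∀ c₁ c₂ : L, c₁ ≠ 0 → c₂ ≠ 0 →
      IsEigensymbol p σ₁ σ₂ k S β hβ Ψ (c₁ ^ m) → IsEigensymbol p σ₁ σ₂ k T δ hδ Ψ (c₂ ^ m) →
      ∀ D : Div0 K, IsSplitAdmissible p (Ψ D) (padicVal p c₁) (padicVal p c₂)) := by
  have hbdd := exists_forall_distNorm_le hK hn hpn hI hΨ
  refine ⟨fun hp S _ c hc hE D => ?_, fun P Q hP hQ hPQ hmul hσP hσQ m hm β δ hβ hδ hPβ hQδ S T _ _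
    c₁ c₂ hc₁ hc₂ hE₁ hE₂ D => ?_⟩
  · have hnorm : ∀ σ : K →+* L, ‖σ ((p : 𝓞 K) : K)‖ ≤ (p : ℝ)⁻¹ := fun σ =>
      (norm_embedding_natCast_self (p := p) σ).le
    exact hE.isAdmissible hc hbdd inv_prime_pos inv_prime_lt_one (hnorm σ₁) (hnorm σ₂)
      (norm_eq_inv_prime_rpow_padicVal hc) D
  · have hp0 : (p : 𝓞 K) ≠ 0 := by exact_mod_cast (Fact.out : p.Prime).ne_zero
    have hcop := isCoprime_of_mul_eq_span hP hQ hPQ hp0 hmul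
    have hβm : β ∈ P ^ m := hPβ ▸ Ideal.mem_span_singleton_self β
    have hδm : δ ∈ Q ^ m := hQδ ▸ Ideal.mem_span_singleton_self δ
    exact hE₁.isSplitAdmissible hE₂ (pow_ne_zero m hc₁) (pow_ne_zero m hc₂) hbdd
      -- Here `q = p⁻ᵐ`, and `m > 0` ensures `q < 1`.
      (pow_pos inv_prime_pos m) (pow_lt_one₀ inv_prime_pos.le inv_prime_lt_one hm.ne')
      (norm_embedding_le_of_mem_pow σ₁ hcop hmul hσP hβm)
      (norm_embedding_le_of_mem_pow σ₂ hcop.symm (by rw [mul_comm, hmul]) hσQ hδm)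
      (norm_pow_eq_inv_prime_pow_rpow_padicVal hc₁ m)
      (norm_pow_eq_inv_prime_pow_rpow_padicVal hc₂ m) D
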